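/- Let $\mathcal N(t)\in\{0,1,2,\dots\}$ and $X(t)\in[0,1]^{\mathcal N(t)}$, $t>0$, be random variables on a common probability space (the number of particles at time $t$ and their positions; $[0,1]^0$ is a single point of mass one). Assume: (1) For all $n\ge 0$ and $t>0$ there is a symmetric function $\rho_n(t,\cdot)$ on $[0,1]^n$ with $\mathbb P(\mathcal N(t)=n,\,X(t)\in A)=\int_A\rho_n(t,x)\,dx$ for every Borel set $A\subseteq[0,1]^n$; for $n=0$ this means $\rho_0(t)=\mathbb P(\mathcal N(t)=0)$. Each $\rho_n$ is continuous on $(0,\infty)\times[0,1]^n$ and, for each $i$, twice continuously differentiable in $x_i\in[0,1]$ (one-sidedly at the end points) with $\partial^2_{x_i}\rho_n$ continuous on $(0,\infty)\times[0,1]^n$. (2) $\lambda_c:[0,1]\to[0,\infty)$ and $\lambda_d:[0,1]^2\to[0,\infty)$ are continuous (hence bounded) and $\lambda_d(x,y)=\lambda_d(y,x)$. (3) Let $\mathtt p_h(x|y)$, $x,y\in[0,1]^n$, be the transition density from $y$ to $x$ in time $h$ of $n$ independent Brownian motions on $[0,1]$ with variance $2h$ and reflection at $0$ and $1$, that is $$\mathtt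 p_h(x|y)=\prod_{i=1}^n\sum_{m\in\mathbb Z}\bigl(g_h(x_i-y_i+2m)+g_h(x_i+y_i+2m)\bigr),\qquad g_h(u)=\frac{e^{-u^2/(4h)}}{\sqrt{4\pi h}}$$ (the Neumann heat kernel of $\sum_i\partial_{x_i}^2$ on $[0,1]^n$; it is $1$ for $n=0$). Write $\mathbb P_{t,h}(n,A\,|\,k,y)$ for the conditional probability $\mathbb P(\mathcal N(t+h)=n,X(t+h)\in A\mid\mathcal N(t)=k,X(t)=y)$. For every $n\ge 0$, Borel $A\subseteq[0,1]^n$ and $t>0$, as $h\downarrow 0$: - if $n\ge 1$, $\displaystyle \mathbb P_{t,h}(n,A\,|\,n-1,y)=\frac hn\sum_{j=1}^n\int_A\int_{[0,1]}\mathtt p_h(x|y\cup_jz)\lambda_c(z)\,dz\,dx+o(h)$, where $y\cup_j z\in[0,1]^n$ is $y$ with $z$ inserted as $j$-th entry; - $\displaystyle \mathbb P_{t,h}(n,A\,|\,n+2,y)=h\sum_{j<k}\lambda_d(y_j,y_k)\int_A\mathtt p_h(x|\hat y_{j,k})\,dx+o(h)$, where $\hat y_{j,k}\in[0,1]^n$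 is $y$ with the $j$-th and $k$-th entries removed; - $\displaystyle \mathbb P_{t,h}(n,A\,|\,n,y)=\Bigl(1-h\int_{[0,1]}\lambda_c(z)\,dz-h\sum_{j<k}\lambda_d(y_j,y_k)\Bigr)\int_A\mathtt p_h(x|y)\,dx+o(h)$; - $\mathbb P_{t,h}(n,A\,|\,k,y)=o(h)$ for $k\notin\{n-1,n,n+2\}$. The remainders (in particular, remainders $\mathcal O(h^2)$ are allowed) are uniform in $y$ (up to null sets of the law at time $t$) and, in the last line, in $k$; they may depend on $n$, $A$ and $t$. Then for all $n\ge 0$, $t>0$ and $(x_1,\dots,x_n)\in[0,1]^n$ the function $\rho_n(\cdot,x_1,\dots,x_n)$ is differentiable at $t$ and \begin{align*} \partial_t\rho_n(t,x_1,\dots,x_n)=&\sum_{i=1}^n\partial^2_{x_i}\rho_n(t,x_1,\dots,x_n)\\ &+\frac{(n+2)(n+1)}2\int_{[0,1]^2}\lambda_d(x,y)\rho_{n+2}(t,x_1,\dots,x_n,x,y)\,dx\,dy-\sum_{i<j}\lambda_d(x_i,x_j)\,\rho_n(t,x_1,\dots,x_n)\\ &+\frac1n\sum_{i=1}^n\lambda_c(x_i)\rho_{n-1}(t,x_1,\dots,x_{i-1},x_{i+1},\dots,x_n)-\int_{[0,1]}\lambda_c(y)\,dy\;\rho_n(t,x_1,\dots,x_n),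 \end{align*} the three finite sums being $0$ for $n=0$. -/

import Mathlib

open MeasureTheory ProbabilityTheory Set
open scoped unitInterval

noncomputable section

namespace CDME

/-- A configuration of the system: the number `n` of particles together with their positions
in `[0,1]`. The cube `[0,1]^n` is `Fin n → I`; for `n = 0` it is a single point. -/
abbrev Config : Type := Σ n : ℕ, (Fin n → I)

instance : BorelSpace Config where
  measurable_eq := by
    have key : ∀ s : Set Config, MeasurableSet s ↔
        ∀ n : ℕ, MeasurableSet ((fun x : Fin n → I => (⟨n, x⟩ : Config)) ⁻¹' s) :=
      fun s => MeasurableSpace.measurableSet_iInf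
    apply le_antisymm
    · intro s hs
      have hs' := (key s).1 hs
      have h2 : s = ⋃ n : ℕ, (fun x : Fin n → I => (⟨n, x⟩ : Config)) ''
          ((fun x : Fin n → I => (⟨n, x⟩ : Config)) ⁻¹' s) := by
        ext ⟨n, x⟩
        simp only [mem_iUnion, mem_image, mem_preimage]
        constructor
        · intro h
          exact ⟨n, x, h, rfl⟩
        · rintro ⟨m, y, h, e⟩
          exact e ▸ h
      let _ : MeasurableSpace Config := borel Config
      have : BorelSpace Config := ⟨rfl⟩
      change MeasurableSet s
      rw [h2]
      exact MeasurableSet.iUnion fun n =>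
        (Topology.IsOpenEmbedding.sigmaMk.measurableEmbedding).measurableSet_image.2 (hs' n)
    · refine MeasurableSpace.generateFrom_le fun s hs => ?_
      exact (key s).2 fun n => (hs.preimage continuous_sigmaMk).measurableSet

instance : Nonempty Config := ⟨⟨0, Fin.elim0⟩⟩

/-- The event `{N = n, X ∈ A}` as a set of configurations. -/
def cell (n : ℕ) (A : Set (Fin n → I)) : Set Config := Sigma.mk n '' A

/-- Transition density, from `y` to `x` in time `h > 0`, of Brownian motion on `[0,1]` with
variance `2h`, reflected at `0` and `1` (the Neumann heat kernel of `∂²` on `[0,1]`): the centred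
Gaussian density of variance `2h`, summed over the images of `y` under the reflections at the two
end points. -/
def reflectedDensity₁ (h : ℝ) (x y : I) : ℝ :=
  ∑' m : ℤ, (gaussianPDFReal 0 (2 * h).toNNReal ((x : ℝ) - y + 2 * m)
    + gaussianPDFReal 0 (2 * h).toNNReal ((x : ℝ) + y + 2 * m))

/-- Transition density `p_h(x|y)` of `n` independent such motions. -/
def reflectedDensity {n : ℕ} (h : ℝ) (x y : Fin n → I) : ℝ :=
  ∏ i, reflectedDensity₁ h (x i) (y i)

/-- The configuration `y` with the particles `j` and `k` removed. The smaller index is given as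
`j : Fin (n + 1)`, so the pairs of particles are the `(j, k)` with `j.castSucc < k`. -/
def removePair {n : ℕ} (y : Fin (n + 2) → I) (j : Fin (n + 1)) (k : Fin (n + 2)) : Fin n → I :=
  j.removeNth (k.removeNth y)

/-- `∑_{j<k} lam (x_j, x_k)`. -/
def pairSum {n : ℕ} (lam : I → I → ℝ) (x : Fin n → I) : ℝ :=
  ∑ j, ∑ k ∈ Finset.Ioi j, lam (x j) (x k)

/-- The conditional probability
`P(N(t+h) = n, X(t+h) ∈ A | N(t) = k, X(t) = y)` as a function of `z = ⟨k, y⟩`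
(determined for almost every `z` with respect to the law of `Z t`). -/
def transProb {Ω : Type*} [MeasurableSpace Ω] (P : Measure Ω) [IsFiniteMeasure P]
    (Z : ℝ → Ω → Config) (t h : ℝ) (n : ℕ) (A : Set (Fin n → I)) (z : Config) : ℝ :=
  (condDistrib (Z (t + h)) (Z t) P z).real (cell n A)

/-- `e h z` is `o(h)` as `h ↓ 0`, uniformly over (almost) all configurations `z` in
`S`. -/
def SmallRemainder (μ : Measure Config) (S : Set Config) (e : ℝ → Config → ℝ) : Prop :=
  ∀ ε > 0, ∃ δ > 0, ∀ h, 0 < h → h < δ → ∀ᵐ z ∂μ, z ∈ S → |e h z| ≤ ε * h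

/-- A remainder that is `O(h²)`, uniformly in the configuration, is a `SmallRemainder`. -/
theorem SmallRemainder.of_sq {μ : Measure Config} {S : Set Config} {e : ℝ → Config → ℝ}
    (H : ∃ C, ∃ δ > 0, ∀ h, 0 < h → h < δ → ∀ᵐ z ∂μ, z ∈ S → |e h z| ≤ C * h ^ 2) :
    SmallRemainder μ S e := by
  obtain ⟨C, δ, hδ, H⟩ := H
  intro ε hε
  have hC : 0 < |C| + 1 := by positivity
  refine ⟨min δ (ε / (|C| + 1)), lt_min hδ (by positivity), fun h h0 h1 => ?_⟩
  filter_upwards [H h h0 (h1.trans_le (min_le_left _ _))] with z hz hzS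
  have h2 : h * (|C| + 1) < ε := (lt_div_iff₀ hC).1 (h1.trans_le (min_le_right _ _))
  refine (hz hzS).trans ?_
  nlinarith [le_abs_self C]

/-- `ρ n t` is, for `t > 0`, a symmetric density of the law of the configuration at time `t` on
the event that there are `n` particles. For `n = 0` the cube is one point of mass one and the
identity says `ρ 0 t = P(N(t) = 0)`. -/
structure IsSymmetricDensity {Ω : Type*} [MeasurableSpace Ω] (P : Measure Ω)
    (Z : ℝ → Ω → Config) (ρ : (n : ℕ) → ℝ → (Fin n → I) → ℝ) : Prop where
  symm : ∀ n, ∀ t > 0, ∀ (τ : Equiv.Perm (Fin n)) (x : Fin n → I), ρ n t (x ∘ τ) = ρ n t x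
  density : ∀ n, ∀ t > 0, ∀ A : Set (Fin n → I), MeasurableSet A →
    P.real {ω | Z t ω ∈ cell n A} = ∫ x in A, ρ n t x

/-- The short-time transition probabilities of the system with creation rate `lc` and pairwise
annihilation rate `ld`, between and after reactions the particles performing independent reflected
Brownian motions. The remainders are uniform in the starting configuration. -/
structure ShortTimeTransitions {Ω : Type*} [MeasurableSpace Ω] (P : Measure Ω)
    [IsFiniteMeasure P] (Z : ℝ → Ω → Config) (lc : I → ℝ) (ld : I → I → ℝ) : Prop where
  /-- creation of one particle and diffusion, from `n` to `n + 1` particles -/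
  creation : ∀ (n : ℕ) (A : Set (Fin (n + 1) → I)), MeasurableSet A → ∀ t > 0,
    ∃ e : ℝ → Config → ℝ, SmallRemainder (P.map (Z t)) {z | z.1 = n} e ∧
      ∀ h > 0, ∀ y : Fin n → I, transProb P Z t h (n + 1) A ⟨n, y⟩ =
        h * (1 / ((n : ℝ) + 1)) * ∑ j : Fin (n + 1),
          (∫ x in A, ∫ z : I, reflectedDensity h x (j.insertNth z y) * lc z) + e h ⟨n, y⟩
  /-- annihilation of a pair and diffusion, from `n + 2` to `n` particles -/
  annihilation : ∀ (n : ℕ) (A : Set (Fin n → I)), MeasurableSet A → ∀ t > 0,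
    ∃ e : ℝ → Config → ℝ, SmallRemainder (P.map (Z t)) {z | z.1 = n + 2} e ∧
      ∀ h > 0, ∀ y : Fin (n + 2) → I, transProb P Z t h n A ⟨n + 2, y⟩ =
        h * (∑ k : Fin (n + 2), ∑ j : Fin (n + 1) with j.castSucc < k,
          ld (y j.castSucc) (y k) * ∫ x in A, reflectedDensity h x (removePair y j k))
          + e h ⟨n + 2, y⟩
  /-- no reaction and diffusion -/
  noReaction : ∀ (n : ℕ) (A : Set (Fin n → I)), MeasurableSet A → ∀ t > 0,
    ∃ e : ℝ → Config → ℝ, SmallRemainder (P.map (Z t)) {z | z.1 = n} e ∧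
      ∀ h > 0, ∀ y : Fin n → I, transProb P Z t h n A ⟨n, y⟩ =
        (1 - h * (∫ z : I, lc z) - h * pairSum ld y) * (∫ x in A, reflectedDensity h x y)
          + e h ⟨n, y⟩
  /-- all other transitions, uniformly in the number `k` of particles at the start -/
  multiple : ∀ (n : ℕ) (A : Set (Fin n → I)), MeasurableSet A → ∀ t > 0,
    SmallRemainder (P.map (Z t)) {z | z.1 + 1 ≠ n ∧ z.1 ≠ n ∧ z.1 ≠ n + 2}
      (fun h z => transProb P Z t h n A z)

/-- The restriction of `f` to the line through `x` in direction `i`, as a function of the real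
coordinate in `[0,1]`. -/
def alongCoord {n : ℕ} (f : (Fin n → I) → ℝ) (i : Fin n) (x : Fin n → I) (u : ℝ) : ℝ :=
  f (Function.update x i (projIcc 0 1 zero_le_one u))

/-- The second partial derivative `∂²_{x_i} f (x)` on the cube (one-sided at its faces). -/
def secondPartial {n : ℕ} (f : (Fin n → I) → ℝ) (i : Fin n) (x : Fin n → I) : ℝ :=
  iteratedDerivWithin 2 (alongCoord f i x) (Icc 0 1) (x i)

/-- Regularity in which the system is understood: for `t > 0`, `ρ n` is continuous in `(t, x)`,
`C²` in every space variable, and the `∂²_{x_i} ρ n` are continuous in `(t, x)`, up to the boundary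
of the cube. Neither differentiability in time nor a boundary condition is required. -/
structure IsSpatiallyC2 (ρ : (n : ℕ) → ℝ → (Fin n → I) → ℝ) : Prop where
  continuousOn : ∀ n, ContinuousOn (fun q : ℝ × (Fin n → I) => ρ n q.1 q.2) (Ioi 0 ×ˢ univ)
  contDiffOn : ∀ n, ∀ t > 0, ∀ (i : Fin n) (x : Fin n → I),
    ContDiffOn ℝ 2 (alongCoord (ρ n t) i x) (Icc 0 1)
  continuousOn_secondPartial : ∀ n (i : Fin n),
    ContinuousOn (fun q : ℝ × (Fin n → I) => secondPartial (ρ n q.1) i q.2) (Ioi 0 ×ˢ univ)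

/-- `(1/n) ∑_i lc (x_i) ρ_{n-1}(t, x_1, …, x_{i-1}, x_{i+1}, …, x_n)`, and `0` for `n = 0`. -/
def creationGain (lc : I → ℝ) (ρ : (n : ℕ) → ℝ → (Fin n → I) → ℝ) (t : ℝ) :
    (n : ℕ) → (Fin n → I) → ℝ
  | 0, _ => 0
  | n + 1, x => (1 / ((n : ℝ) + 1)) * ∑ i : Fin (n + 1), lc (x i) * ρ n t (i.removeNth x)

/-- The right-hand side of the chemical diffusion master equation. -/
def rhs (lc : I → ℝ) (ld : I → I → ℝ) (ρ : (n : ℕ) → ℝ → (Fin n → I) → ℝ)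
    (n : ℕ) (t : ℝ) (x : Fin n → I) : ℝ :=
  (∑ i, secondPartial (ρ n t) i x)
    + ((n : ℝ) + 2) * ((n : ℝ) + 1) / 2 *
      (∫ q : I × I, ld q.1 q.2 * ρ (n + 2) t (Fin.append x ![q.1, q.2]))
    - pairSum ld x * ρ n t x
    + creationGain lc ρ t n x
    - (∫ y : I, lc y) * ρ n t x

end CDME

end

/-! Fix a Borel set `A` inside a cube `[δ, 1 - δ]ⁿ` and condition on the configuration at time `t`.
By total probability, `P(N(t+h) = n, X(t+h) ∈ A)` is a sum over the number `k` of particles at time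
`t`. The cases `k = n - 1` and `k = n + 2` carry a factor `h`, so their limits after division by `h`
are found by replacing the diffusion by the identity. Exchangeability makes all annihilated pairs
contribute equally, whence the binomial coefficient. The case `k = n` contains the diffusion at
order one and produces the Laplacian; all else is `o(h)`.

For the Laplacian, reflected Brownian motion is Gaussian motion on the line folded onto `[0,1]`, and
the sum over images is the density of the folded Gaussian (`map_fold_gaussianReal`). Symmetry of the
kernel moves the diffusion from the rough indicator of `A` to the smooth density
(`integral_hitProb_mul`). The particles are then displaced one at a time, and each displacement is
averaged with its mirror image, so that only pure second differences remain (`diffuse_sub_self`).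
Dominated convergence with the Gaussian second moment gives the generator. No boundary condition is
assumed, so this is done only away from the faces.

This yields the right derivative in time of `∫_A ρ_n` (`tendsto_slope_setIntegral`). The candidate
derivative is continuous in time, so a continuous function with that right derivative is its
primitive (`setIntegral_sub_eq`). Fubini and the arbitrariness of `A` give the time-integrated
equation at almost every `x`. Both sides are continuous in `x`, so it holds everywhere, faces
included (`density_sub_eq`). The fundamental theorem of calculus then gives the two-sided time
derivative. -/

noncomputable section
namespace CDME
open Filter Topology

/-! ### Folding the line onto the unit interval -/

/-- The even `2`-periodic extension of the identity of `[0,1]`, as a map onto `[0,1]`. -/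
def fold (u : ℝ) : I :=
  ⟨Real.arccos (Real.cos (Real.pi * u)) / Real.pi,
    div_nonneg (Real.arccos_nonneg _) Real.pi_pos.le,
    (div_le_one Real.pi_pos).2 (Real.arccos_le_pi _)⟩

@[fun_prop]
theorem continuous_fold : Continuous fold := by
  unfold fold
  refine Continuous.subtype_mk ?_ _
  exact ((Real.continuous_arccos.comp (Real.continuous_cos.comp (by fun_prop)))).div_const _

theorem coe_fold_of_mem {u : ℝ} (hu : u ∈ Icc (0 : ℝ) 1) : (fold u : ℝ) = u := by
  have hpi := Real.pi_pos
  simp only [fold]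
  rw [Real.arccos_cos (mul_nonneg hpi.le hu.1) (by nlinarith [hu.2])]
  field_simp

theorem fold_coe (x : I) : fold (x : ℝ) = x := Subtype.ext (coe_fold_of_mem x.2)

theorem fold_neg (u : ℝ) : fold (-u) = fold u := by
  simp [fold]

theorem fold_add_two_mul_int (u : ℝ) (m : ℤ) : fold (u + 2 * m) = fold u := by
  have : Real.pi * (u + 2 * m) = Real.pi * u + m * (2 * Real.pi) := by ring
  simp only [fold, this, Real.cos_add_int_mul_two_pi]

/-- Full support is what later upgrades almost everywhere equality of continuous functions on the
cube to equality. -/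
instance : (volume : Measure I).IsOpenPosMeasure where
  open_pos := by
    rintro U hU ⟨x, hx⟩
    obtain ⟨V, hV, rfl⟩ := isOpen_induced_iff.1 hU
    -- The given point may be an end point of the interval, but it still lies in the closure of the
    -- open interval.
    have hne : (V ∩ Ioo (0 : ℝ) 1).Nonempty := by
      have hc : (x : ℝ) ∈ closure (Ioo (0 : ℝ) 1) := by
        rw [closure_Ioo zero_ne_one]
        exact x.2
      exact mem_closure_iff.1 hc V hV hx
    have hpos := (hV.inter isOpen_Ioo).measure_pos volume hne
    rw [unitInterval.volume_apply]
    refine (hpos.trans_le (measure_mono ?_)).ne'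
    rintro u ⟨huV, hu⟩
    exact ⟨⟨u, hu.1.le, hu.2.le⟩, huV, rfl⟩

theorem lintegral_unitInterval (f : ℝ → ENNReal) :
    ∫⁻ y : I, f y = ∫⁻ u in Icc (0 : ℝ) 1, f u :=
  lintegral_subtype_comap measurableSet_Icc f

/-- Unfolding an integral over the line against the folding map. -/
theorem lintegral_fold_mul (F : I → ENNReal) (hF : Measurable F) (g : ℝ → ENNReal)
    (hg : Measurable g) :
    ∫⁻ u, F (fold u) * g u
      = ∫⁻ y : I, F y * ∑' m : ℤ, (g (y + 2 * m) + g (-y + 2 * m)) := by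
  have hfold : Measurable fold := continuous_fold.measurable
  -- Each period is translated back to `(-1, 1]`; by periodicity of `fold` only `g` feels the shift.
  have hshift : ∀ m : ℤ, ∫⁻ u in Ioc ((-1 : ℝ) + m • (2 : ℝ)) (-1 + (m + 1) • (2 : ℝ)),
      F (fold u) * g u = ∫⁻ u in Ioc (-1 : ℝ) 1, F (fold u) * g (u + 2 * m) := by
    intro m
    have hp := measurePreserving_add_right (volume : Measure ℝ) (2 * m : ℝ)
    have hemb : MeasurableEmbedding (fun u : ℝ => u + 2 * m) :=
      (MeasurableEquiv.addRight (2 * m : ℝ)).measurableEmbedding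
    have := hp.setLIntegral_comp_preimage_emb hemb (fun u => F (fold u) * g u)
      (Ioc ((-1 : ℝ) + m • (2 : ℝ)) (-1 + (m + 1) • (2 : ℝ)))
    rw [← this]
    simp only [fold_add_two_mul_int]
    congr 2
    ext u
    simp only [mem_preimage, mem_Ioc, zsmul_eq_mul]
    push_cast
    constructor <;> rintro ⟨h1, h2⟩ <;> constructor <;> linarith
  have hmeas : ∀ m : ℤ, Measurable fun u : ℝ => g (u + 2 * m) := fun m => by fun_prop
  set G : ℝ → ENNReal := fun u => ∑' m : ℤ, g (u + 2 * m) with hG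
  have hGm : Measurable G := Measurable.tsum hmeas
  calc ∫⁻ u, F (fold u) * g u
      = ∑' m : ℤ, ∫⁻ u in Ioc ((-1 : ℝ) + m • (2 : ℝ)) (-1 + (m + 1) • (2 : ℝ)),
          F (fold u) * g u := by
        rw [← lintegral_iUnion (fun _ => measurableSet_Ioc)
          (pairwise_disjoint_Ioc_add_zsmul (-1 : ℝ) 2), iUnion_Ioc_add_zsmul two_pos,
          Measure.restrict_univ]
    _ = ∫⁻ u in Ioc (-1 : ℝ) 1, F (fold u) * G u := by
        simp only [hshift]
        rw [← lintegral_tsum (fun m => by fun_prop)]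
        simp only [hG, ENNReal.tsum_mul_left]
    -- Evenness of `fold` reflects the negative half-period onto `[0,1]`, which creates the images
    -- at `-y`.
    _ = (∫⁻ u in Icc (0 : ℝ) 1, F (fold u) * G (-u)) + ∫⁻ u in Icc (0 : ℝ) 1, F (fold u) * G u := by
        rw [← Ioc_union_Ioc_eq_Ioc (show (-1 : ℝ) ≤ 0 by norm_num) zero_le_one,
          lintegral_union measurableSet_Ioc
            (Set.disjoint_left.2 fun u h1 h2 => absurd h1.2 (not_le.2 h2.1))]
        congr 1
        · have hp := Measure.measurePreserving_neg (volume : Measure ℝ)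
          have := hp.setLIntegral_comp_preimage_emb (MeasurableEquiv.neg ℝ).measurableEmbedding
            (fun u => F (fold u) * G u) (Ioc (-1) 0)
          rw [← this]
          simp only [fold_neg]
          have hpre : Neg.neg ⁻¹' Ioc (-1 : ℝ) 0 = Ico 0 1 := by
            simp
          rw [hpre, restrict_Ico_eq_restrict_Icc]
        · rw [restrict_Ioc_eq_restrict_Icc]
    _ = ∫⁻ u in Icc (0 : ℝ) 1, F (fold u) * ∑' m : ℤ, (g (u + 2 * m) + g (-u + 2 * m)) := by
        rw [← lintegral_add_left (by fun_prop)]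
        simp only [hG, ENNReal.tsum_add, ← mul_add, add_comm]
    _ = _ := by
        rw [← lintegral_unitInterval
          (fun u => F (fold u) * ∑' m : ℤ, (g (u + 2 * m) + g (-u + 2 * m)))]
        simp only [fold_coe]

/-! ### The reflected kernel as the density of a folded Gaussian -/

/-- `reflectedDensity₁` as an extended nonnegative number. -/
def reflectedENN (h : ℝ) (x y : I) : ENNReal :=
  ∑' m : ℤ, (gaussianPDF 0 (2 * h).toNNReal ((x : ℝ) - y + 2 * m)
    + gaussianPDF 0 (2 * h).toNNReal ((x : ℝ) + y + 2 * m))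

/-- No convergence is needed: each term is finite, and if the series diverged both sides would be
`0`. -/
theorem reflectedDensity₁_eq_toReal (h : ℝ) (x y : I) :
    reflectedDensity₁ h x y = (reflectedENN h x y).toReal := by
  rw [reflectedENN, ENNReal.tsum_toReal_eq]
  · simp only [reflectedDensity₁]
    refine tsum_congr fun m => ?_
    rw [ENNReal.toReal_add gaussianPDF_ne_top gaussianPDF_ne_top]
    simp [toReal_gaussianPDF]
  · exact fun m => ENNReal.add_ne_top.2 ⟨gaussianPDF_ne_top, gaussianPDF_ne_top⟩

theorem measurable_reflectedENN (h : ℝ) :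
    Measurable fun q : I × I => reflectedENN h q.1 q.2 := by
  unfold reflectedENN
  refine Measurable.tsum fun m => ?_
  have := measurable_gaussianPDF 0 (2 * h).toNNReal
  fun_prop

theorem measurable_reflectedDensity₁ (h : ℝ) :
    Measurable fun q : I × I => reflectedDensity₁ h q.1 q.2 := by
  simp only [reflectedDensity₁_eq_toReal]
  exact (measurable_reflectedENN h).ennreal_toReal

theorem gaussianPDF_zero_neg (v : NNReal) (u : ℝ) :
    gaussianPDF 0 v (-u) = gaussianPDF 0 v u := by
  simp [gaussianPDF, gaussianPDFReal]

/-- Method of images: after centring the Gaussian at `x`, unfolding the integral over the line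
yields the sum over reflected and translated copies. -/
theorem map_fold_gaussianReal_eq_withDensity_enn {h : ℝ} (hh : 0 < h) (x : I) :
    (gaussianReal 0 (2 * h).toNNReal).map (fun w => fold (x + w))
      = volume.withDensity (reflectedENN h x) := by
  have hv : (2 * h).toNNReal ≠ 0 := by
    rw [Ne, Real.toNNReal_eq_zero]; linarith
  have hfold : Measurable fold := continuous_fold.measurable
  set v := (2 * h).toNNReal with hvdef
  have hgm := measurable_gaussianPDF 0 v
  ext s hs
  rw [Measure.map_apply (by fun_prop) hs, withDensity_apply _ hs,
    ← lintegral_indicator_one ((by fun_prop : Measurable fun w => fold (x + w)) hs),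
    gaussianReal_of_var_ne_zero _ hv, lintegral_withDensity_eq_lintegral_mul _ hgm
      (measurable_one.indicator ((by fun_prop : Measurable fun w => fold (x + w)) hs))]
  have hFm : Measurable (s.indicator (1 : I → ENNReal)) := measurable_one.indicator hs
  have h1 := lintegral_fold_mul (s.indicator 1) hFm (fun u => gaussianPDF 0 v (u - x))
    (by fun_prop)
  have h2 := lintegral_add_right_eq_self
    (fun u => s.indicator (1 : I → ENNReal) (fold u) * gaussianPDF 0 v (u - x)) (x : ℝ) (μ := volume)
  rw [← lintegral_indicator hs]
  have h3 : ∫⁻ w, (gaussianPDF 0 v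
      * ((fun w : ℝ => fold (x + w)) ⁻¹' s).indicator (1 : ℝ → ENNReal) : ℝ → ENNReal) w
      = ∫⁻ u, s.indicator (1 : I → ENNReal) (fold (u + x)) * gaussianPDF 0 v (u + x - x) := by
    refine lintegral_congr fun w => ?_
    rw [Pi.mul_apply, add_sub_cancel_right, mul_comm, add_comm w]
    rfl
  rw [h3, h2, h1]
  refine lintegral_congr fun y => ?_
  have h4 : ∑' m : ℤ, (gaussianPDF 0 v ((y : ℝ) + 2 * m - x) + gaussianPDF 0 v (-(y : ℝ) + 2 * m - x))
      = reflectedENN h x y := by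
    -- Replacing `m` by `-m` and using evenness of the Gaussian exchanges the roles of the two
    -- points.
    rw [reflectedENN, ← (Equiv.neg ℤ).tsum_eq]
    refine tsum_congr fun m => ?_
    rw [← gaussianPDF_zero_neg v ((y : ℝ) + _ - x), ← gaussianPDF_zero_neg v (-(y : ℝ) + _ - x)]
    simp only [Equiv.neg_apply, Int.cast_neg]
    congr 2 <;> ring
  rw [h4]
  by_cases hy : y ∈ s <;> simp [hy]

/-- The extended density has finite total mass, hence is finite almost everywhere, and passing to
real values changes it only on a null set. -/
theorem map_fold_gaussianReal {h : ℝ} (hh : 0 < h) (x : I) :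
    (gaussianReal 0 (2 * h).toNNReal).map (fun w => fold (x + w))
      = volume.withDensity fun y => ENNReal.ofReal (reflectedDensity₁ h x y) := by
  have hfold : Measurable fold := continuous_fold.measurable
  rw [map_fold_gaussianReal_eq_withDensity_enn hh x]
  refine withDensity_congr_ae ?_
  have hm : Measurable (reflectedENN h x) :=
    (measurable_reflectedENN h).of_uncurry_left (x := x)
  have hfin : ∫⁻ y, reflectedENN h x y ≠ ⊤ := by
    have := map_fold_gaussianReal_eq_withDensity_enn hh x
    rw [← setLIntegral_univ, ← withDensity_apply _ MeasurableSet.univ, ← this]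
    exact measure_ne_top _ _
  filter_upwards [ae_lt_top hm hfin] with y hy
  rw [reflectedDensity₁_eq_toReal, ENNReal.ofReal_toReal hy.ne]

theorem reflectedENN_comm (h : ℝ) (x y : I) : reflectedENN h x y = reflectedENN h y x := by
  simp only [reflectedENN, ENNReal.tsum_add]
  congr 1
  · rw [← (Equiv.neg ℤ).tsum_eq]
    refine tsum_congr fun m => ?_
    rw [← gaussianPDF_zero_neg]
    simp only [Equiv.neg_apply, Int.cast_neg]
    congr 1; ring
  · simp only [add_comm (x : ℝ)]

theorem reflectedDensity₁_comm (h : ℝ) (x y : I) :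
    reflectedDensity₁ h x y = reflectedDensity₁ h y x := by
  rw [reflectedDensity₁_eq_toReal, reflectedENN_comm, ← reflectedDensity₁_eq_toReal]

theorem reflectedDensity₁_nonneg (h : ℝ) (x y : I) : 0 ≤ reflectedDensity₁ h x y := by
  rw [reflectedDensity₁_eq_toReal]
  exact ENNReal.toReal_nonneg

theorem reflectedDensity_comm {n : ℕ} (h : ℝ) (x y : Fin n → I) :
    reflectedDensity h x y = reflectedDensity h y x :=
  Finset.prod_congr rfl fun i _ => reflectedDensity₁_comm h (x i) (y i)

theorem reflectedDensity_nonneg {n : ℕ} (h : ℝ) (x y : Fin n → I) :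
    0 ≤ reflectedDensity h x y :=
  Finset.prod_nonneg fun i _ => reflectedDensity₁_nonneg h (x i) (y i)

theorem measurable_reflectedDensity {n : ℕ} (h : ℝ) :
    Measurable fun q : (Fin n → I) × (Fin n → I) => reflectedDensity h q.1 q.2 := by
  have hi : ∀ i, Measurable fun q : (Fin n → I) × (Fin n → I) =>
      reflectedDensity₁ h (q.1 i) (q.2 i) := by
    intro i
    have hq : Measurable fun q : (Fin n → I) × (Fin n → I) => (q.1 i, q.2 i) := by fun_prop
    have hc := (measurable_reflectedDensity₁ h).comp hq
    simp only [Function.comp_def] at hc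
    exact hc
  exact Finset.measurable_fun_prod Finset.univ fun i _ => hi i

theorem integrable_reflectedDensity₁ {h : ℝ} (hh : 0 < h) (x : I) :
    Integrable (reflectedDensity₁ h x) := by
  have hfold : Measurable fold := continuous_fold.measurable
  have hm : Measurable (reflectedDensity₁ h x) :=
    (measurable_reflectedDensity₁ h).of_uncurry_left (x := x)
  refine ⟨hm.aestronglyMeasurable, ?_⟩
  rw [hasFiniteIntegral_iff_ofReal (ae_of_all _ fun y => reflectedDensity₁_nonneg h x y)]
  have := map_fold_gaussianReal hh x
  rw [← setLIntegral_univ, ← withDensity_apply _ MeasurableSet.univ, ← this]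
  exact measure_lt_top _ _

/-- A product of densities is the density of the product measure. -/
theorem pi_withDensity_ofReal {ι : Type*} [Fintype ι] {X : ι → Type*}
    [∀ i, MeasureSpace (X i)] [∀ i, SigmaFinite (volume : Measure (X i))]
    (f : ∀ i, X i → ℝ) (hf : ∀ i, Integrable (f i)) (hf0 : ∀ i y, 0 ≤ f i y) :
    Measure.pi (fun i => (volume : Measure (X i)).withDensity fun y => ENNReal.ofReal (f i y))
      = volume.withDensity fun y => ENNReal.ofReal (∏ i, f i (y i)) := by
  have hfin : ∀ i, IsFiniteMeasure
      ((volume : Measure (X i)).withDensity fun y => ENNReal.ofReal (f i y)) := fun i =>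
    isFiniteMeasure_withDensity_ofReal (hf i).2
  refine Measure.pi_eq fun s hs => ?_
  rw [withDensity_apply _ (MeasurableSet.univ_pi hs), volume_pi, Measure.restrict_pi_pi,
    ← ofReal_integral_eq_lintegral_ofReal
      (Integrable.fintype_prod_dep fun i => (hf i).restrict)
      (ae_of_all _ fun y => Finset.prod_nonneg fun i _ => hf0 i _),
    integral_fintype_prod_eq_prod, ENNReal.ofReal_prod_of_nonneg
      (fun i _ => integral_nonneg fun y => hf0 i y)]
  refine Finset.prod_congr rfl fun i _ => ?_
  rw [withDensity_apply _ (hs i), ofReal_integral_eq_lintegral_ofReal (hf i).restrict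
    (ae_of_all _ fun y => hf0 i y)]

/-- Standard Gaussian measure on `ℝⁿ`. -/
abbrev stdGaussianPi (n : ℕ) : Measure (Fin n → ℝ) := Measure.pi fun _ => gaussianReal 0 1

/-- Writing the displacement as `√(2h)` times a standard Gaussian keeps one probability measure for
all `h`, as dominated convergence in `h` requires. -/
theorem map_fold_stdGaussianPi {n : ℕ} {h : ℝ} (hh : 0 < h) (x : Fin n → I) :
    (stdGaussianPi n).map (fun w i => fold (x i + √(2 * h) * w i))
      = volume.withDensity fun y => ENNReal.ofReal (reflectedDensity h x y) := by
  have hfold : Measurable fold := continuous_fold.measurable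
  have h1 : ∀ i, (gaussianReal 0 1).map (fun w => fold (x i + √(2 * h) * w))
      = volume.withDensity fun y => ENNReal.ofReal (reflectedDensity₁ h (x i) y) := by
    intro i
    rw [← map_fold_gaussianReal hh (x i)]
    have h2 : gaussianReal 0 (2 * h).toNNReal = (gaussianReal 0 1).map (fun w => √(2 * h) * w) := by
      rw [gaussianReal_map_const_mul]
      congr 1
      · simp
      · ext
        have h3 : 0 ≤ 2 * h := by linarith
        simp only [Real.coe_toNNReal _ h3, mul_one, NNReal.coe_mk, Real.sq_sqrt h3]
    rw [h2, Measure.map_map (by fun_prop) (by fun_prop)]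
    rfl
  rw [stdGaussianPi]
  have hprob : ∀ i, IsProbabilityMeasure ((gaussianReal 0 1).map
    (fun w => fold (x i + √(2 * h) * w))) := fun i =>
      Measure.isProbabilityMeasure_map (by fun_prop)
  rw [Measure.pi_map_pi (f := fun i w => fold (x i + √(2 * h) * w)) (fun i => by fun_prop)]
  simp only [h1]
  exact pi_withDensity_ofReal _ (fun i => integrable_reflectedDensity₁ hh (x i))
    fun i y => reflectedDensity₁_nonneg h (x i) y

theorem measurable_reflectedDensity_right {n : ℕ} (h : ℝ) (x : Fin n → I) :
    Measurable fun y => reflectedDensity h x y :=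
  (measurable_reflectedDensity h).of_uncurry_left (x := x)

theorem lintegral_reflectedDensity {n : ℕ} {h : ℝ} (hh : 0 < h) (x : Fin n → I) :
    ∫⁻ y, ENNReal.ofReal (reflectedDensity h x y) = 1 := by
  have := map_fold_stdGaussianPi hh x
  have hp : IsProbabilityMeasure
      ((stdGaussianPi n).map (fun w i => fold (x i + √(2 * h) * w i))) :=
    Measure.isProbabilityMeasure_map (by fun_prop : Continuous _).aemeasurable
  rw [← setLIntegral_univ, ← withDensity_apply _ MeasurableSet.univ, ← this]
  exact measure_univ

theorem integrable_reflectedDensity {n : ℕ} {h : ℝ} (hh : 0 < h) (x : Fin n → I) :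
    Integrable fun y => reflectedDensity h x y := by
  refine ⟨(measurable_reflectedDensity_right h x).aestronglyMeasurable, ?_⟩
  rw [hasFiniteIntegral_iff_ofReal (ae_of_all _ fun y => reflectedDensity_nonneg h x y),
    lintegral_reflectedDensity hh x]
  exact ENNReal.one_lt_top

theorem integral_reflectedDensity {n : ℕ} {h : ℝ} (hh : 0 < h) (x : Fin n → I) :
    ∫ y, reflectedDensity h x y = 1 := by
  rw [integral_eq_lintegral_of_nonneg_ae (ae_of_all _ fun y => reflectedDensity_nonneg h x y)
    (measurable_reflectedDensity_right h x).aestronglyMeasurable, lintegral_reflectedDensity hh x,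
    ENNReal.toReal_one]

/-! ### The heat semigroup and its duality with hitting probabilities -/

/-- The Neumann heat semigroup on the cube. -/
def diffuse {n : ℕ} (h : ℝ) (f : (Fin n → I) → ℝ) (x : Fin n → I) : ℝ :=
  ∫ w, f (fun i => fold (x i + √(2 * h) * w i)) ∂stdGaussianPi n

theorem integral_reflectedDensity_mul {n : ℕ} {h : ℝ} (hh : 0 < h) {f : (Fin n → I) → ℝ}
    (hf : Measurable f) (x : Fin n → I) :
    ∫ y, reflectedDensity h x y * f y = diffuse h f x := by
  rw [diffuse, ← integral_map (φ := fun (w : Fin n → ℝ) i => fold (x i + √(2 * h) * w i))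
    (f := f) (by fun_prop : Continuous _).aemeasurable hf.aestronglyMeasurable, map_fold_stdGaussianPi hh x,
    integral_withDensity_eq_integral_toReal_smul
      (measurable_reflectedDensity_right h x).ennreal_ofReal
      (ae_of_all _ fun _ => ENNReal.ofReal_lt_top)]
  simp only [ENNReal.toReal_ofReal (reflectedDensity_nonneg h x _), smul_eq_mul]

/-- The probability to be in `A` after diffusing for time `h` from `y`. -/
def hitProb {n : ℕ} (h : ℝ) (A : Set (Fin n → I)) (y : Fin n → I) : ℝ :=
  ∫ x in A, reflectedDensity h x y

theorem integrable_reflectedDensity_left {n : ℕ} {h : ℝ} (hh : 0 < h) (y : Fin n → I) :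
    Integrable fun x => reflectedDensity h x y := by
  simp only [reflectedDensity_comm h _ y]
  exact integrable_reflectedDensity hh y

theorem hitProb_nonneg {n : ℕ} (h : ℝ) (A : Set (Fin n → I)) (y : Fin n → I) :
    0 ≤ hitProb h A y :=
  integral_nonneg fun x => reflectedDensity_nonneg h x y

theorem hitProb_le_one {n : ℕ} {h : ℝ} (hh : 0 < h) (A : Set (Fin n → I)) (y : Fin n → I) :
    hitProb h A y ≤ 1 := by
  rw [← integral_reflectedDensity hh y]
  simp only [← reflectedDensity_comm h _ y]
  exact setIntegral_le_integral (integrable_reflectedDensity_left hh y)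
    (ae_of_all _ fun x => reflectedDensity_nonneg h x y)

theorem abs_hitProb_le_one {n : ℕ} {h : ℝ} (hh : 0 < h) (A : Set (Fin n → I)) (y : Fin n → I) :
    |hitProb h A y| ≤ 1 := by
  rw [abs_of_nonneg (hitProb_nonneg h A y)]
  exact hitProb_le_one hh A y

theorem measurable_hitProb {n : ℕ} (h : ℝ) (A : Set (Fin n → I)) : Measurable (hitProb h A) :=
  ((measurable_reflectedDensity h).stronglyMeasurable.integral_prod_left'
    (μ := volume.restrict A)).measurable

theorem setIntegral_integral_reflectedDensity {n : ℕ} {h : ℝ} (hh : 0 < h) (A : Set (Fin n → I))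
    {X : Type*} [MeasurableSpace X] (ν : Measure X) [SFinite ν] {φ : X → Fin n → I}
    (hφ : Measurable φ) {g : X → ℝ} (hg : Integrable g ν) :
    ∫ x in A, ∫ z, reflectedDensity h x (φ z) * g z ∂ν = ∫ z, hitProb h A (φ z) * g z ∂ν := by
  have hpm : Measurable fun q : (Fin n → I) × X => reflectedDensity h q.1 (φ q.2) := by
    have hq : Measurable fun q : (Fin n → I) × X => (q.1, φ q.2) := by fun_prop
    have hc := (measurable_reflectedDensity h).comp hq
    simp only [Function.comp_def] at hc
    exact hc
  have hint : Integrable (Function.uncurry fun (x : Fin n → I) z => reflectedDensity h x (φ z) * g z)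
      ((volume.restrict A).prod ν) := by
    refine (integrable_prod_iff' ?_).2 ⟨?_, ?_⟩
    · exact hpm.aestronglyMeasurable.mul hg.1.comp_snd
    · exact ae_of_all _ fun z =>
        ((integrable_reflectedDensity_left hh (φ z)).restrict (s := A)).mul_const (g z)
    · have : (fun z => ∫ x in A, ‖Function.uncurry
          (fun (x : Fin n → I) z => reflectedDensity h x (φ z) * g z) (x, z)‖)
          = fun z => hitProb h A (φ z) * ‖g z‖ := by
        funext z
        simp only [Function.uncurry_apply_pair, norm_mul, Real.norm_eq_abs,
          abs_of_nonneg (reflectedDensity_nonneg h _ _), integral_mul_const, hitProb]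
      rw [this]
      exact hg.norm.bdd_mul ((measurable_hitProb h A).comp hφ).aestronglyMeasurable
        (ae_of_all _ fun z => abs_hitProb_le_one hh A (φ z))
  rw [integral_integral_swap hint]
  simp only [integral_mul_const, hitProb]

/-- Self-adjointness of the semigroup: the kernel is both the forward and the backward transition
density. The indicator of `A` is not smooth, so the `h`-dependence has to be moved onto `f`. -/
theorem integral_hitProb_mul {n : ℕ} {h : ℝ} (hh : 0 < h) (A : Set (Fin n → I))
    {f : (Fin n → I) → ℝ} (hf : Continuous f) :
    ∫ y, hitProb h A y * f y = ∫ x in A, diffuse h f x := by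
  have := setIntegral_integral_reflectedDensity hh A volume measurable_id
    (hf.integrable_of_hasCompactSupport (HasCompactSupport.of_compactSpace f))
  simp only [id, integral_reflectedDensity_mul hh hf.measurable] at this
  exact this.symm

theorem exists_abs_le {X : Type*} [TopologicalSpace X] [CompactSpace X] {f : X → ℝ}
    (hf : Continuous f) : ∃ M, 0 ≤ M ∧ ∀ x, |f x| ≤ M := by
  obtain ⟨M, hM⟩ := isCompact_univ.exists_bound_of_continuousOn hf.continuousOn
  exact ⟨max M 0, le_max_right _ _, fun x => (hM x (mem_univ x)).trans (le_max_left _ _)⟩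

theorem abs_integral_le {X : Type*} [MeasurableSpace X] {μ : Measure X}
    [IsProbabilityMeasure μ] {f : X → ℝ} {M : ℝ} (hM : ∀ x, |f x| ≤ M) : |∫ x, f x ∂μ| ≤ M := by
  have := norm_integral_le_of_norm_le_const (μ := μ) (f := f) (ae_of_all _ hM)
  simpa using this

theorem continuous_diffuse {n : ℕ} (h : ℝ) {f : (Fin n → I) → ℝ} (hf : Continuous f) :
    Continuous (diffuse h f) := by
  obtain ⟨M, -, hM⟩ := exists_abs_le hf
  refine continuous_of_dominated (bound := fun _ => M) (fun x => ?_) (fun x => ?_)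
    (integrable_const _) ?_
  · exact (by fun_prop : Continuous _).aestronglyMeasurable
  · exact ae_of_all _ fun w => hM _
  · exact ae_of_all _ fun w => by fun_prop

theorem tendsto_sqrt_two_mul : Tendsto (fun h : ℝ => √(2 * h)) (𝓝[>] 0) (𝓝 0) := by
  have : Continuous fun h : ℝ => √(2 * h) := by fun_prop
  simpa using (this.tendsto 0).mono_left nhdsWithin_le_nhds

theorem tendsto_fold_add {l : Filter ℝ} {s : ℝ → ℝ} (hs : Tendsto s l (𝓝 0)) (x : I) :
    Tendsto (fun h => fold (x + s h)) l (𝓝 x) := by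
  have h1 : Tendsto (fun h => (x : ℝ) + s h) l (𝓝 x) := by
    simpa using (tendsto_const_nhds (x := (x : ℝ))).add hs
  have h2 := (continuous_fold.tendsto (x : ℝ)).comp h1
  rw [fold_coe] at h2
  exact h2

theorem tendsto_diffuse {n : ℕ} {f : (Fin n → I) → ℝ} (hf : Continuous f) (x : Fin n → I) :
    Tendsto (fun h => diffuse h f x) (𝓝[>] 0) (𝓝 (f x)) := by
  obtain ⟨M, -, hM⟩ := exists_abs_le hf
  have h1 : f x = ∫ _, f x ∂stdGaussianPi n := by simp
  rw [h1]
  refine tendsto_integral_filter_of_dominated_convergence (fun _ => M) ?_ ?_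
    (integrable_const _) ?_
  · exact Eventually.of_forall fun h => (by fun_prop : Continuous _).aestronglyMeasurable
  · exact Eventually.of_forall fun h => ae_of_all _ fun w => hM _
  · refine ae_of_all _ fun w => (hf.tendsto x).comp (tendsto_pi_nhds.2 fun i => ?_)
    refine tendsto_fold_add ?_ (x i)
    simpa using tendsto_sqrt_two_mul.mul_const (w i)

theorem tendsto_setIntegral_diffuse {n : ℕ} {f : (Fin n → I) → ℝ} (hf : Continuous f)
    (A : Set (Fin n → I)) :
    Tendsto (fun h => ∫ x in A, diffuse h f x) (𝓝[>] 0) (𝓝 (∫ x in A, f x)) := by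
  obtain ⟨M, -, hM⟩ := exists_abs_le hf
  refine tendsto_integral_filter_of_dominated_convergence (fun _ => M) ?_ ?_
    (integrable_const _) ?_
  · exact Eventually.of_forall fun h => (continuous_diffuse h hf).aestronglyMeasurable
  · exact Eventually.of_forall fun h => ae_of_all _ fun w => abs_integral_le fun w => hM _
  · exact ae_of_all _ fun x => tendsto_diffuse hf x

/-- Serves the reaction terms: they already carry a factor `h`, so continuity of the semigroup at
`0` is enough and `A` may touch the faces. -/
theorem tendsto_integral_hitProb_mul {n : ℕ} {f : (Fin n → I) → ℝ} (hf : Continuous f)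
    (A : Set (Fin n → I)) :
    Tendsto (fun h => ∫ y, hitProb h A y * f y) (𝓝[>] 0) (𝓝 (∫ x in A, f x)) := by
  refine (tendsto_setIntegral_diffuse hf A).congr' ?_
  filter_upwards [self_mem_nhdsWithin] with h hh
  rw [integral_hitProb_mul hh A hf]

/-! ### Second differences and the folding map -/

/-- Mean value form of the symmetric second difference. -/
theorem exists_second_difference_eq {F : ℝ → ℝ} (hF : ContDiffOn ℝ 2 F (Icc 0 1)) {x s : ℝ}
    (hs : 0 < s) (h0 : 0 ≤ x - s) (h1 : x + s ≤ 1) :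
    ∃ ξ ∈ Ioo (x - s) (x + s), F (x + s) + F (x - s) - 2 * F x
      = s ^ 2 * iteratedDerivWithin 2 F (Icc 0 1) ξ := by
  have hu : UniqueDiffOn ℝ (Icc (0 : ℝ) 1) := uniqueDiffOn_Icc zero_lt_one
  set F' := derivWithin F (Icc 0 1) with hF'
  have hF'c : ContDiffOn ℝ 1 F' (Icc 0 1) := hF.derivWithin hu (by norm_num)
  have hd : ∀ u ∈ Ioo (0 : ℝ) 1, HasDerivAt F (F' u) u := fun u hu' =>
    ((hF.differentiableOn (by norm_num) u (Ioo_subset_Icc_self hu')).hasDerivWithinAt).hasDerivAt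
      (Icc_mem_nhds hu'.1 hu'.2)
  have hd2 : ∀ u ∈ Ioo (0 : ℝ) 1, HasDerivAt F' (iteratedDerivWithin 2 F (Icc 0 1) u) u := by
    intro u hu'
    have := ((hF'c.differentiableOn (by norm_num) u
      (Ioo_subset_Icc_self hu')).hasDerivWithinAt).hasDerivAt (Icc_mem_nhds hu'.1 hu'.2)
    rwa [show iteratedDerivWithin 2 F (Icc 0 1) u = derivWithin F' (Icc 0 1) u by
      rw [show (2 : ℕ) = 1 + 1 from rfl, iteratedDerivWithin_succ]
      exact derivWithin_congr (fun v hv => by rw [iteratedDerivWithin_one])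
        (by rw [iteratedDerivWithin_one])]
  -- Cauchy's mean value theorem against `r ^ 2` reduces the second difference to `(F' (x + c) - F'
  -- (x - c)) / (2 * c)`; the usual mean value theorem for `F'` finishes.
  obtain ⟨c, hc, hceq⟩ := exists_ratio_hasDerivAt_eq_ratio_slope
    (fun r => F (x + r) + F (x - r)) (fun r => F' (x + r) - F' (x - r)) hs
    (by
      refine ContinuousOn.add ?_ ?_
      · exact hF.continuousOn.comp (by fun_prop) fun r hr => ⟨by linarith [hr.1], by linarith [hr.2]⟩
      · exact hF.continuousOn.comp (by fun_prop)
          fun r hr => ⟨by linarith [hr.2], by linarith [hr.1]⟩)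
    (fun r hr => by
      have e1 := (hd (x + r) ⟨by linarith [hr.1], by linarith [hr.2]⟩).comp_const_add x r
      have e2 := (hd (x - r) ⟨by linarith [hr.2], by linarith [hr.1]⟩).comp_const_sub x r
      have e3 := e1.fun_add e2
      rwa [← sub_eq_add_neg] at e3)
    (fun r => r ^ 2) (fun r => 2 * r) (by fun_prop)
    (fun r _ => by simpa using hasDerivAt_pow 2 r)
  have hcc : x - c < x + c := by linarith [hc.1]
  obtain ⟨ξ, hξ, hξeq⟩ := exists_hasDerivAt_eq_slope F' (iteratedDerivWithin 2 F (Icc 0 1)) hcc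
    (hF'c.continuousOn.mono fun r hr => ⟨by linarith [hr.1, hc.2], by linarith [hr.2, hc.2]⟩)
    (fun r hr => hd2 r ⟨by linarith [hr.1, hc.2], by linarith [hr.2, hc.2]⟩)
  refine ⟨ξ, ⟨by linarith [hξ.1, hc.2], by linarith [hξ.2, hc.2]⟩, ?_⟩
  have hc0 : 0 < c := hc.1
  rw [hξeq, show x + c - (x - c) = 2 * c by ring]
  field_simp
  simp only [add_zero, sub_zero] at hceq
  linear_combination -hceq

/-- The symmetric second difference of `f ∘ fold` in direction `i`. -/
def secondDiff {n : ℕ} (f : (Fin n → I) → ℝ) (i : Fin n) (z : Fin n → I) (s : ℝ) : ℝ :=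
  f (Function.update z i (fold (z i + s))) + f (Function.update z i (fold (z i - s))) - 2 * f z

/-- Continuity, with continuous pure second partial derivatives up to the boundary. -/
structure IsC2 {n : ℕ} (f : (Fin n → I) → ℝ) : Prop where
  continuous : Continuous f
  contDiffOn : ∀ i x, ContDiffOn ℝ 2 (alongCoord f i x) (Icc 0 1)
  continuous_secondPartial : ∀ i, Continuous (secondPartial f i)

theorem secondDiff_neg {n : ℕ} (f : (Fin n → I) → ℝ) (i : Fin n) (z : Fin n → I) (s : ℝ) :
    secondDiff f i z (-s) = secondDiff f i z s := by
  simp only [secondDiff, sub_neg_eq_add, ← sub_eq_add_neg]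
  ring

/-- A displacement shorter than the distance to both faces is not folded, so the mean value form on
the interval applies. -/
theorem IsC2.exists_secondDiff_eq {n : ℕ} {f : (Fin n → I) → ℝ} (hf : IsC2 f) (i : Fin n)
    (z : Fin n → I) {s : ℝ} (h0 : |s| ≤ z i) (h1 : z i + |s| ≤ 1) :
    ∃ ξ : I, |(ξ : ℝ) - z i| ≤ |s| ∧
      secondDiff f i z s = s ^ 2 * secondPartial f i (Function.update z i ξ) := by
  rcases eq_or_ne s 0 with rfl | hs
  · refine ⟨z i, by simp, ?_⟩
    simp only [secondDiff, add_zero, sub_zero, fold_coe, Function.update_eq_self]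
    ring
  have hs' : 0 < |s| := abs_pos.2 hs
  obtain ⟨ξ, hξ, hE⟩ := exists_second_difference_eq (hf.contDiffOn i z) hs'
    (by linarith : 0 ≤ (z i : ℝ) - |s|) h1
  have hξI : ξ ∈ Icc (0 : ℝ) 1 := ⟨by linarith [hξ.1], by linarith [hξ.2]⟩
  refine ⟨⟨ξ, hξI⟩, abs_le.2 ⟨by linarith [hξ.1], by linarith [hξ.2]⟩, ?_⟩
  have hsd : secondDiff f i z s = secondDiff f i z |s| := by
    rcases abs_choice s with h | h <;> rw [h]
    rw [secondDiff_neg]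
  have hal : ∀ u ∈ Icc (0 : ℝ) 1, alongCoord f i z u = f (Function.update z i (fold u)) := by
    intro u hu
    simp only [alongCoord, projIcc_of_mem zero_le_one hu]
    congr 2
    exact Subtype.ext (coe_fold_of_mem hu).symm
  have hI := (z i).2
  rw [hal _ ⟨by linarith, h1⟩, hal _ ⟨by linarith, by linarith⟩, hal _ hI, fold_coe,
    Function.update_eq_self, sq_abs] at hE
  rw [hsd, secondDiff, hE, secondPartial]
  congr 2
  · funext u
    simp [alongCoord]
  · simp

/-- For `|s| ≤ δ` the second derivative bound `M₂` suffices. For `|s| > δ` folding may occur, but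
the trivial bound `4 * M` is at most `4 * M / δ ^ 2 * s ^ 2`. The constant depends on `δ`, since a
nonzero normal derivative gives `f ∘ fold` a kink at the faces. -/
theorem IsC2.exists_secondDiff_bound {n : ℕ} {f : (Fin n → I) → ℝ} (hf : IsC2 f) (i : Fin n)
    {δ : ℝ} (hδ : 0 < δ) :
    ∃ C, 0 ≤ C ∧ ∀ (z : Fin n → I), δ ≤ z i → (z i : ℝ) ≤ 1 - δ → ∀ s,
      |secondDiff f i z s| ≤ C * s ^ 2 := by
  obtain ⟨M, hM0, hM⟩ := exists_abs_le hf.continuous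
  obtain ⟨M₂, hM₂0, hM₂⟩ := exists_abs_le (hf.continuous_secondPartial i)
  refine ⟨M₂ + 4 * M / δ ^ 2, by positivity, fun z h0 h1 s => ?_⟩
  rcases le_or_gt |s| δ with hs | hs
  · obtain ⟨ξ, -, hE⟩ := hf.exists_secondDiff_eq i z (s := s) (by linarith) (by linarith)
    rw [hE, abs_mul, abs_of_nonneg (sq_nonneg s), mul_comm]
    refine mul_le_mul_of_nonneg_right ((hM₂ _).trans ?_) (sq_nonneg s)
    have : 0 ≤ 4 * M / δ ^ 2 := by positivity
    linarith
  · have hb : |secondDiff f i z s| ≤ 4 * M := by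
      have a1 := abs_le.1 (hM (Function.update z i (fold (z i + s))))
      have a2 := abs_le.1 (hM (Function.update z i (fold (z i - s))))
      have a3 := abs_le.1 (hM z)
      unfold secondDiff
      exact abs_le.2 ⟨by linarith, by linarith⟩
    have hsq : δ ^ 2 ≤ s ^ 2 := by
      rw [← sq_abs s]
      exact pow_le_pow_left₀ hδ.le hs.le 2
    calc |secondDiff f i z s| ≤ 4 * M := hb
      _ = 4 * M / δ ^ 2 * δ ^ 2 := by field_simp
      _ ≤ 4 * M / δ ^ 2 * s ^ 2 := by gcongr
      _ ≤ (M₂ + 4 * M / δ ^ 2) * s ^ 2 := by gcongr; linarith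

/-! ### Moving one particle at a time: the generator away from the faces -/

/-- The configuration `x` after the first `k` particles have moved by `s • w`. -/
def moveFirst {n : ℕ} (x : Fin n → I) (s : ℝ) (k : ℕ) (w : Fin n → ℝ) : Fin n → I :=
  fun j => if (j : ℕ) < k then fold (x j + s * w j) else x j

@[fun_prop]
theorem continuous_moveFirst {n : ℕ} (x : Fin n → I) (s : ℝ) (k : ℕ) :
    Continuous (moveFirst x s k) := by
  refine continuous_pi fun j => ?_
  unfold moveFirst
  split_ifs <;> fun_prop

theorem moveFirst_zero {n : ℕ} (x : Fin n → I) (s : ℝ) (w : Fin n → ℝ) :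
    moveFirst x s 0 w = x := by
  funext j
  simp [moveFirst]

theorem moveFirst_self {n : ℕ} (x : Fin n → I) (s : ℝ) (w : Fin n → ℝ) :
    moveFirst x s n w = fun j => fold (x j + s * w j) := by
  funext j
  simp [moveFirst]

theorem moveFirst_apply_self {n : ℕ} (x : Fin n → I) (s : ℝ) (i : Fin n) (w : Fin n → ℝ) :
    moveFirst x s i w i = x i := by
  simp [moveFirst]

theorem moveFirst_succ {n : ℕ} (x : Fin n → I) (s : ℝ) (i : Fin n) (w : Fin n → ℝ) :
    moveFirst x s (i + 1) w
      = Function.update (moveFirst x s i w) i (fold (moveFirst x s i w i + s * w i)) := by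
  rw [moveFirst_apply_self]
  funext j
  rcases eq_or_ne j i with rfl | hj
  · simp [moveFirst]
  · rw [Function.update_of_ne hj]
    have : (j : ℕ) ≠ i := fun h => hj (Fin.ext h)
    simp only [moveFirst]
    congr 1
    simp only [eq_iff_iff]
    omega

/-- Reflection of the `i`-th coordinate. -/
def flipCoord {n : ℕ} (i : Fin n) (w : Fin n → ℝ) : Fin n → ℝ :=
  fun j => if j = i then -w j else w j

theorem flipCoord_self {n : ℕ} (i : Fin n) (w : Fin n → ℝ) : flipCoord i w i = -w i := by
  simp [flipCoord]

theorem moveFirst_flipCoord {n : ℕ} (x : Fin n → I) (s : ℝ) (i : Fin n) (w : Fin n → ℝ) :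
    moveFirst x s i (flipCoord i w) = moveFirst x s i w := by
  funext j
  rcases eq_or_ne j i with rfl | hj
  · simp [moveFirst]
  · simp [moveFirst, flipCoord, hj]

theorem measurePreserving_flipCoord {n : ℕ} (i : Fin n) :
    MeasurePreserving (flipCoord i) (stdGaussianPi n) (stdGaussianPi n) := by
  have : ∀ j : Fin n, MeasurePreserving (fun u : ℝ => if j = i then -u else u)
      (gaussianReal 0 1) (gaussianReal 0 1) := by
    intro j
    by_cases h : j = i
    · simp only [h, if_true]
      exact ⟨measurable_neg, by simpa using gaussianReal_map_neg (μ := 0) (v := 1)⟩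
    · simp only [h, if_false]
      exact MeasurePreserving.id _
  exact measurePreserving_pi (fun _ => gaussianReal 0 1) (fun _ => gaussianReal 0 1) this

theorem integrable_of_continuous_of_abs_le {X : Type*} [TopologicalSpace X] [MeasurableSpace X]
    [OpensMeasurableSpace X] {μ : Measure X} [IsFiniteMeasure μ] {f : X → ℝ} (hf : Continuous f)
    {M : ℝ} (hM : ∀ x, |f x| ≤ M) : Integrable f μ :=
  Integrable.of_bound hf.measurable.aestronglyMeasurable M (ae_of_all _ hM)

theorem continuous_secondDiff {n : ℕ} {f : (Fin n → I) → ℝ} (hf : Continuous f) (i : Fin n) :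
    Continuous fun q : (Fin n → I) × ℝ => secondDiff f i q.1 q.2 := by
  unfold secondDiff
  fun_prop

/-- The Gaussian is invariant under a sign change of its `i`-th coordinate, which the earlier moves
do not involve. Averaging the move with its mirror image cancels the first-order part without any
expansion. -/
theorem integral_moveFirst_succ_sub {n : ℕ} {f : (Fin n → I) → ℝ} (hf : Continuous f)
    (x : Fin n → I) (s : ℝ) (i : Fin n) :
    ∫ w, (f (moveFirst x s (i + 1) w) - f (moveFirst x s i w)) ∂stdGaussianPi n
      = 2⁻¹ * ∫ w, secondDiff f i (moveFirst x s i w) (s * w i) ∂stdGaussianPi n := by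
  obtain ⟨M, -, hM⟩ := exists_abs_le hf
  have hint : ∀ k, Integrable (fun w => f (moveFirst x s k w)) (stdGaussianPi n) := fun k =>
    integrable_of_continuous_of_abs_le (by fun_prop) fun w => hM _
  have hflip : ∀ w, f (moveFirst x s (i + 1) (flipCoord i w))
      = f (Function.update (moveFirst x s i w) i (fold (moveFirst x s i w i - s * w i))) := by
    intro w
    rw [moveFirst_succ, moveFirst_flipCoord, flipCoord_self, mul_neg, ← sub_eq_add_neg]
  have hintf : Integrable (fun w => f (moveFirst x s (i + 1) (flipCoord i w)))
      (stdGaussianPi n) :=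
    (measurePreserving_flipCoord i).integrable_comp_of_integrable (hint (i + 1))
  have heq : ∫ w, f (moveFirst x s (i + 1) (flipCoord i w)) ∂stdGaussianPi n
      = ∫ w, f (moveFirst x s (i + 1) w) ∂stdGaussianPi n := by
    have hmp := measurePreserving_flipCoord i
    have := integral_map (μ := stdGaussianPi n) hmp.measurable.aemeasurable
      (f := fun w => f (moveFirst x s (i + 1) w)) (by rw [hmp.map_eq]; exact (hint _).1)
    rw [hmp.map_eq] at this
    exact this.symm
  have hsd : ∀ w, secondDiff f i (moveFirst x s i w) (s * w i)
      = f (moveFirst x s (i + 1) w) + f (moveFirst x s (i + 1) (flipCoord i w))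
        - 2 * f (moveFirst x s i w) := by
    intro w
    rw [hflip, moveFirst_succ, secondDiff]
  simp only [hsd]
  rw [integral_sub ((hint _).fun_add hintf) ((hint _).const_mul 2), integral_add (hint _) hintf,
    integral_const_mul, heq, integral_sub (hint _) (hint _)]
  ring

/-- A telescoping sum over the particles. Moving them singly avoids mixed derivatives, about which
nothing is assumed. -/
theorem diffuse_sub_self {n : ℕ} {f : (Fin n → I) → ℝ} (hf : Continuous f) (h : ℝ)
    (x : Fin n → I) :
    diffuse h f x - f x = ∑ i : Fin n,
      2⁻¹ * ∫ w, secondDiff f i (moveFirst x √(2 * h) i w) (√(2 * h) * w i) ∂stdGaussianPi n := by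
  obtain ⟨M, -, hM⟩ := exists_abs_le hf
  set s := √(2 * h)
  have hint : ∀ k, Integrable (fun w => f (moveFirst x s k w)) (stdGaussianPi n) := fun k =>
    integrable_of_continuous_of_abs_le (by fun_prop) fun w => hM _
  simp only [← integral_moveFirst_succ_sub hf, integral_sub (hint _) (hint _)]
  rw [Fin.sum_univ_eq_sum_range (fun i => (∫ w, f (moveFirst x s (i + 1) w) ∂stdGaussianPi n)
    - ∫ w, f (moveFirst x s i w) ∂stdGaussianPi n) n,
    Finset.sum_range_sub (fun i => ∫ w, f (moveFirst x s i w) ∂stdGaussianPi n)]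
  simp only [moveFirst_self, moveFirst_zero, integral_const, probReal_univ, one_smul]
  rfl

theorem integrable_sq_gaussianReal : Integrable (fun u : ℝ => u ^ 2) (gaussianReal 0 1) := by
  have := (memLp_id_gaussianReal (μ := 0) (v := 1) 2).integrable_sq
  simpa using this

theorem integral_sq_gaussianReal : ∫ u : ℝ, u ^ 2 ∂gaussianReal 0 1 = 1 := by
  have h := variance_id_gaussianReal (μ := 0) (v := 1)
  rw [variance_of_integral_eq_zero (by fun_prop) (by simp)] at h
  simpa using h

theorem integrable_eval_sq {n : ℕ} (i : Fin n) :
    Integrable (fun w : Fin n → ℝ => w i ^ 2) (stdGaussianPi n) :=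
  integrable_comp_eval (μ := fun _ : Fin n => gaussianReal 0 1) (f := fun u : ℝ => u ^ 2)
    integrable_sq_gaussianReal

theorem integral_eval_sq {n : ℕ} (i : Fin n) : ∫ w : Fin n → ℝ, w i ^ 2 ∂stdGaussianPi n = 1 := by
  rw [integral_comp_eval (μ := fun _ : Fin n => gaussianReal 0 1) (f := fun u : ℝ => u ^ 2)
    integrable_sq_gaussianReal.1, integral_sq_gaussianReal]

theorem tendsto_moveFirst {n : ℕ} (x : Fin n → I) (k : ℕ) (w : Fin n → ℝ) :
    Tendsto (fun h : ℝ => moveFirst x √(2 * h) k w) (𝓝[>] 0) (𝓝 x) := by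
  refine tendsto_pi_nhds.2 fun j => ?_
  unfold moveFirst
  split_ifs
  · exact tendsto_fold_add (by simpa using tendsto_sqrt_two_mul.mul_const (w j)) (x j)
  · exact tendsto_const_nhds

theorem IsC2.tendsto_secondDiff {n : ℕ} {f : (Fin n → I) → ℝ} (hf : IsC2 f) (i : Fin n)
    (x : Fin n → I) (h0 : 0 < x i) (h1 : x i < 1) (w : Fin n → ℝ) :
    Tendsto (fun h => h⁻¹ * (2⁻¹ * secondDiff f i (moveFirst x √(2 * h) i w) (√(2 * h) * w i)))
      (𝓝[>] 0) (𝓝 (secondPartial f i x * w i ^ 2)) := by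
  have hs0 : Tendsto (fun h : ℝ => |√(2 * h) * w i|) (𝓝[>] 0) (𝓝 0) := by
    simpa using (tendsto_sqrt_two_mul.mul_const (w i)).abs
  have h0' : (0 : ℝ) < x i := h0
  have h1' : (x i : ℝ) < 1 := h1
  -- The size condition sits inside the existential so that `ξ` can be chosen for every `h`; when it
  -- fails, `0` is a dummy value.
  have hex : ∀ h : ℝ, ∃ ξ : I, |√(2 * h) * w i| < min (x i : ℝ) (1 - x i) →
      |(ξ : ℝ) - x i| ≤ |√(2 * h) * w i| ∧
      secondDiff f i (moveFirst x √(2 * h) i w) (√(2 * h) * w i)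
        = (√(2 * h) * w i) ^ 2
          * secondPartial f i (Function.update (moveFirst x √(2 * h) i w) i ξ) := by
    intro h
    by_cases hlt : |√(2 * h) * w i| < min (x i : ℝ) (1 - x i)
    · have hx := moveFirst_apply_self x √(2 * h) i w
      obtain ⟨ξ, hξ⟩ := hf.exists_secondDiff_eq i (moveFirst x √(2 * h) i w)
        (s := √(2 * h) * w i) (by rw [hx]; exact (hlt.trans_le (min_le_left _ _)).le)
        (by rw [hx]; linarith [hlt.trans_le (min_le_right _ _)])
      rw [hx] at hξ
      exact ⟨ξ, fun _ => hξ⟩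
    · exact ⟨0, fun h => absurd h hlt⟩
  choose ξ hξ using hex
  have hev : ∀ᶠ h in 𝓝[>] (0 : ℝ), |√(2 * h) * w i| < min (x i : ℝ) (1 - x i) :=
    hs0.eventually (gt_mem_nhds (lt_min h0' (by linarith)))
  have hξt : Tendsto ξ (𝓝[>] 0) (𝓝 (x i)) := by
    rw [tendsto_iff_dist_tendsto_zero]
    refine squeeze_zero' (Eventually.of_forall fun _ => dist_nonneg) ?_ hs0
    filter_upwards [hev] with h hh
    exact (hξ h hh).1
  have hlim : Tendsto (fun h => secondPartial f i
      (Function.update (moveFirst x √(2 * h) i w) i (ξ h)) * w i ^ 2) (𝓝[>] 0)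
      (𝓝 (secondPartial f i x * w i ^ 2)) := by
    refine Tendsto.mul_const _ ?_
    have h2 := ((tendsto_moveFirst x i w).update i hξt)
    rw [Function.update_eq_self] at h2
    exact ((hf.continuous_secondPartial i).tendsto x).comp h2
  refine hlim.congr' ?_
  filter_upwards [hev, self_mem_nhdsWithin] with h hh hpos
  have hpos' : (0 : ℝ) < h := hpos
  -- The `2` in the variance `2h` cancels the `2⁻¹` from symmetrization, so the generator has
  -- coefficient one.
  rw [(hξ h hh).2, mul_pow, Real.sq_sqrt (by linarith)]
  field_simp

theorem IsC2.exists_abs_secondDiff_moveFirst_le {n : ℕ} {f : (Fin n → I) → ℝ} (hf : IsC2 f)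
    (i : Fin n) {δ : ℝ} (hδ : 0 < δ) :
    ∃ C, 0 ≤ C ∧ ∀ (x : Fin n → I), δ ≤ x i → (x i : ℝ) ≤ 1 - δ → ∀ h > 0, ∀ w : Fin n → ℝ,
      |h⁻¹ * (2⁻¹ * secondDiff f i (moveFirst x √(2 * h) i w) (√(2 * h) * w i))|
        ≤ C * w i ^ 2 := by
  obtain ⟨C, hC0, hC⟩ := hf.exists_secondDiff_bound i hδ
  refine ⟨C, hC0, fun x hx0 hx1 h hh w => ?_⟩
  have hx := moveFirst_apply_self x √(2 * h) i w
  have hb := hC (moveFirst x √(2 * h) i w) (by rwa [hx]) (by rwa [hx]) (√(2 * h) * w i)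
  rw [mul_pow, Real.sq_sqrt (by linarith)] at hb
  rw [abs_mul, abs_mul, abs_of_pos (inv_pos.2 hh), abs_of_pos (by norm_num : (0 : ℝ) < 2⁻¹)]
  calc h⁻¹ * (2⁻¹ * |secondDiff f i (moveFirst x √(2 * h) i w) (√(2 * h) * w i)|)
      ≤ h⁻¹ * (2⁻¹ * (C * (2 * h * w i ^ 2))) := by gcongr
    _ = C * w i ^ 2 := by field_simp

/-- The cube `[δ, 1 - δ]ⁿ`. -/
def innerCube (n : ℕ) (δ : ℝ) : Set (Fin n → I) := {x | ∀ i, δ ≤ (x i : ℝ) ∧ (x i : ℝ) ≤ 1 - δ}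

/-- The integrand tends to `secondPartial f i x * w i ^ 2` under the majorant `C * w i ^ 2`, and the
coordinate has unit variance. -/
theorem IsC2.tendsto_diffuse_sub {n : ℕ} {f : (Fin n → I) → ℝ} (hf : IsC2 f) {δ : ℝ}
    (hδ : 0 < δ) {x : Fin n → I} (hx : x ∈ innerCube n δ) :
    Tendsto (fun h => h⁻¹ * (diffuse h f x - f x)) (𝓝[>] 0) (𝓝 (∑ i, secondPartial f i x)) := by
  simp only [diffuse_sub_self hf.continuous, Finset.mul_sum]
  refine tendsto_finsetSum _ fun i _ => ?_
  obtain ⟨C, hC0, hC⟩ := hf.exists_abs_secondDiff_moveFirst_le i hδ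
  have hlim : secondPartial f i x
      = ∫ w : Fin n → ℝ, secondPartial f i x * w i ^ 2 ∂stdGaussianPi n := by
    rw [integral_const_mul, integral_eval_sq, mul_one]
  rw [hlim]
  simp only [← integral_const_mul]
  have hcont := continuous_secondDiff hf.continuous i
  refine tendsto_integral_filter_of_dominated_convergence (fun w => C * w i ^ 2) ?_ ?_
    ((integrable_eval_sq i).const_mul C) ?_
  · refine Eventually.of_forall fun h => Continuous.aestronglyMeasurable ?_
    have : Continuous fun w : Fin n → ℝ => (moveFirst x √(2 * h) i w, √(2 * h) * w i) := by fun_prop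
    have hc := hcont.comp this
    simp only [Function.comp_def] at hc
    exact (hc.const_mul _).const_mul _
  · filter_upwards [self_mem_nhdsWithin] with h hh
    exact ae_of_all _ fun w => hC x (hx i).1 (hx i).2 h hh w
  · refine ae_of_all _ fun w => hf.tendsto_secondDiff i x ?_ ?_ w
    · exact hδ.trans_le (hx i).1
    · exact Subtype.coe_lt_coe.1 (show (x i : ℝ) < (1 : I) by
        have := (hx i).2
        simp only [Icc.coe_one]
        linarith)

theorem IsC2.exists_abs_diffuse_sub_le {n : ℕ} {f : (Fin n → I) → ℝ} (hf : IsC2 f) {δ : ℝ}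
    (hδ : 0 < δ) :
    ∃ C, ∀ x ∈ innerCube n δ, ∀ h > 0, |h⁻¹ * (diffuse h f x - f x)| ≤ C := by
  choose C hC0 hC using fun i => hf.exists_abs_secondDiff_moveFirst_le i hδ
  refine ⟨∑ i, C i, fun x hx h hh => ?_⟩
  rw [diffuse_sub_self hf.continuous, Finset.mul_sum]
  refine (Finset.abs_sum_le_sum_abs _ _).trans (Finset.sum_le_sum fun i _ => ?_)
  rw [← integral_const_mul, ← integral_const_mul]
  have := norm_integral_le_of_norm_le ((integrable_eval_sq i).const_mul (C i))
    (ae_of_all (stdGaussianPi n) fun w =>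
      (Real.norm_eq_abs _).trans_le (hC i x (hx i).1 (hx i).2 h hh w))
  rwa [integral_const_mul (C i), integral_eval_sq, mul_one] at this

/-- The bound on the difference quotient is uniform only on an inner cube. At a face with nonzero
normal derivative the quotient can blow up like `h ^ (-1/2)`. -/
theorem IsC2.tendsto_setIntegral_diffuse_sub {n : ℕ} {f : (Fin n → I) → ℝ} (hf : IsC2 f) {δ : ℝ}
    (hδ : 0 < δ) {A : Set (Fin n → I)} (hA : MeasurableSet A) (hAδ : A ⊆ innerCube n δ) :
    Tendsto (fun h => h⁻¹ * ((∫ x in A, diffuse h f x) - ∫ x in A, f x)) (𝓝[>] 0)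
      (𝓝 (∫ x in A, ∑ i, secondPartial f i x)) := by
  obtain ⟨C, hC⟩ := hf.exists_abs_diffuse_sub_le hδ
  have hint : ∀ {g : (Fin n → I) → ℝ}, Continuous g → IntegrableOn g A := fun hg =>
    (hg.integrable_of_hasCompactSupport (HasCompactSupport.of_compactSpace _)).integrableOn
  simp only [← integral_sub (hint (continuous_diffuse _ hf.continuous)) (hint hf.continuous),
    ← integral_const_mul]
  refine tendsto_integral_filter_of_dominated_convergence (fun _ => C) ?_ ?_
    (integrable_const _) ?_
  · exact Eventually.of_forall fun h =>
      (((continuous_diffuse h hf.continuous).sub hf.continuous).const_mul _).aestronglyMeasurable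
  · filter_upwards [self_mem_nhdsWithin] with h hh
    filter_upwards [ae_restrict_mem hA] with x hx
    exact hC x (hAδ hx) h hh
  · filter_upwards [ae_restrict_mem hA] with x hx
    exact hf.tendsto_diffuse_sub hδ (hAδ hx)

/-! ### Integrals over the cube and insertion of particles -/

theorem integrable_of_continuous {X : Type*} [TopologicalSpace X] [CompactSpace X]
    [MeasurableSpace X] [OpensMeasurableSpace X] {μ : Measure X} [IsFiniteMeasure μ] {g : X → ℝ}
    (hg : Continuous g) : Integrable g μ := by
  obtain ⟨M, -, hM⟩ := exists_abs_le hg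
  exact integrable_of_continuous_of_abs_le hg hM

theorem integrable_hitProb_mul {n m : ℕ} {h : ℝ} (hh : 0 < h) (A : Set (Fin n → I))
    {φ : (Fin m → I) → Fin n → I} (hφ : Measurable φ) {g : (Fin m → I) → ℝ} (hg : Continuous g) :
    Integrable fun y => hitProb h A (φ y) * g y :=
  (integrable_of_continuous hg).bdd_mul ((measurable_hitProb h A).comp hφ).aestronglyMeasurable
    (ae_of_all _ fun z => abs_hitProb_le_one hh A (φ z))

/-- Splitting off the `j`-th coordinate of an integral over the cube. -/
theorem integrable_insertNth {n : ℕ} (j : Fin (n + 1)) {G : (Fin (n + 1) → I) → ℝ}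
    (hG : Integrable G) :
    Integrable fun q : I × (Fin n → I) => G (j.insertNth q.1 q.2) :=
  ((volume_preserving_piFinSuccAbove (fun _ : Fin (n + 1) => I) j).symm.integrable_comp_emb
    (MeasurableEquiv.measurableEmbedding _)).2 hG

theorem integral_insertNth {n : ℕ} (j : Fin (n + 1)) {G : (Fin (n + 1) → I) → ℝ}
    (hG : Integrable G) :
    ∫ u, G u = ∫ y : Fin n → I, ∫ z : I, G (j.insertNth z y) := by
  rw [← (volume_preserving_piFinSuccAbove (fun _ : Fin (n + 1) => I) j).symm.integral_comp' G]
  exact integral_prod_symm _ (integrable_insertNth j hG)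

theorem insertNth_comp {n : ℕ} {α β : Type*} (j : Fin (n + 1)) (a : α) (v : Fin n → α)
    (u : α → β) : u ∘ (j.insertNth a v : Fin (n + 1) → α) = j.insertNth (u a) (u ∘ v) := by
  funext i
  refine Fin.succAboveCases j ?_ (fun i => ?_) i <;> simp

/-- A symmetric function does not see where two entries are inserted. -/
theorem symm_insertNth_insertNth {n : ℕ} {f : (Fin (n + 2) → I) → ℝ}
    (hf : ∀ (τ : Equiv.Perm (Fin (n + 2))) x, f (x ∘ τ) = f x) (k : Fin (n + 2)) (j : Fin (n + 1))
    (a b : I) (x : Fin n → I) :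
    f (k.insertNth b (j.insertNth a x : Fin (n + 1) → I)) = f (Fin.append x ![a, b]) := by
  -- Performing the same two insertions on the labels instead of the positions produces the required
  -- permutation; a surjection of a finite set is bijective.
  set v : Fin (n + 1) → Fin (n + 2) := j.insertNth (Fin.natAdd n 0) (Fin.castAdd 2) with hv
  set ψ : Fin (n + 2) → Fin (n + 2) := k.insertNth (Fin.natAdd n 1) v with hψ
  have hsurj : Function.Surjective ψ := by
    intro i
    refine Fin.addCases (fun i => ?_) (fun i => ?_) i
    · exact ⟨k.succAbove (j.succAbove i), by simp [hψ, hv]⟩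
    · fin_cases i
      · exact ⟨k.succAbove j, by simp [hψ, hv]⟩
      · exact ⟨k, by simp [hψ]⟩
  have hbij : Function.Bijective ψ := ⟨Finite.injective_iff_surjective.2 hsurj, hsurj⟩
  have hcomp : (k.insertNth b (j.insertNth a x : Fin (n + 1) → I) : Fin (n + 2) → I)
      = Fin.append x ![a, b] ∘ Equiv.ofBijective ψ hbij := by
    have h1 : (Fin.append x ![a, b] : Fin (n + 2) → I) ∘ Fin.castAdd 2 = x := by
      funext i
      simp
    rw [Equiv.coe_ofBijective, hψ, insertNth_comp, hv, insertNth_comp, h1]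
    simp only [Fin.append_right]
    rfl
  rw [hcomp, hf]

/-! ### The law of the configuration and total probability -/

theorem measurableEmbedding_sigmaMk (n : ℕ) :
    MeasurableEmbedding (fun x : Fin n → I => (⟨n, x⟩ : Config)) :=
  (@Topology.IsOpenEmbedding.sigmaMk ℕ (fun n => Fin n → I) _ n).measurableEmbedding

theorem measurableSet_cell {n : ℕ} {A : Set (Fin n → I)} (hA : MeasurableSet A) :
    MeasurableSet (cell n A) :=
  (measurableEmbedding_sigmaMk n).measurableSet_image.2 hA

theorem continuous_number : Continuous (fun z : Config => z.1) :=
  continuous_sigma fun _ => continuous_const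

theorem measurableSet_number (p : ℕ → Prop) : MeasurableSet {z : Config | p z.1} :=
  continuous_number.measurable (MeasurableSet.of_discrete (s := {k | p k}))

theorem IsSpatiallyC2.continuous {ρ : (n : ℕ) → ℝ → (Fin n → I) → ℝ} (hreg : IsSpatiallyC2 ρ)
    (n : ℕ) {t : ℝ} (ht : 0 < t) : Continuous (ρ n t) := by
  rw [← continuousOn_univ]
  exact (hreg.continuousOn n).comp (f := fun x => (t, x)) (by fun_prop) fun x _ => ⟨ht, mem_univ _⟩

theorem IsSpatiallyC2.isC2 {ρ : (n : ℕ) → ℝ → (Fin n → I) → ℝ} (hreg : IsSpatiallyC2 ρ)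
    (n : ℕ) {t : ℝ} (ht : 0 < t) : IsC2 (ρ n t) where
  continuous := hreg.continuous n ht
  contDiffOn := hreg.contDiffOn n t ht
  continuous_secondPartial i := by
    rw [← continuousOn_univ]
    exact (hreg.continuousOn_secondPartial n i).comp (f := fun x => (t, x)) (by fun_prop)
      fun x _ => ⟨ht, mem_univ _⟩

section Law

variable {Ω : Type*} [MeasurableSpace Ω] {P : Measure Ω}
  {Z : ℝ → Ω → Config} {ρ : (n : ℕ) → ℝ → (Fin n → I) → ℝ} {t : ℝ}

/-- No sign is imposed on `ρ`; it comes from the integrals over Borel sets being probabilities. -/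
theorem IsSymmetricDensity.ae_nonneg (hρ : IsSymmetricDensity P Z ρ) (hreg : IsSpatiallyC2 ρ)
    (ht : 0 < t) (n : ℕ) : 0 ≤ᵐ[volume] ρ n t := by
  refine ae_nonneg_of_forall_setIntegral_nonneg
    (integrable_of_continuous (hreg.continuous n ht)) fun s hs _ => ?_
  rw [← hρ.density n t ht s hs]
  exact measureReal_nonneg

variable [IsProbabilityMeasure P]

/-- The law of the configuration on the event that there are `k` particles. -/
theorem IsSymmetricDensity.restrict_law (hρ : IsSymmetricDensity P Z ρ)
    (hreg : IsSpatiallyC2 ρ) (ht : 0 < t) (hZ : Measurable (Z t)) (k : ℕ) :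
    (P.map (Z t)).restrict {z | z.1 = k}
      = (volume.withDensity fun y => ENNReal.ofReal (ρ k t y)).map
        (fun x : Fin k → I => (⟨k, x⟩ : Config)) := by
  have hemb := measurableEmbedding_sigmaMk k
  ext s hs
  have hpre := hemb.measurable hs
  have hset : s ∩ {z : Config | z.1 = k} = cell k ((fun x => (⟨k, x⟩ : Config)) ⁻¹' s) := by
    ext ⟨m, y⟩
    simp only [mem_inter_iff, mem_ofPred_eq, cell, mem_image, mem_preimage]
    constructor
    · rintro ⟨h1, rfl⟩
      exact ⟨y, h1, rfl⟩
    · rintro ⟨x, hx, he⟩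
      exact ⟨he ▸ hx, (congrArg Sigma.fst he).symm⟩
  rw [Measure.restrict_apply hs, hemb.map_apply, withDensity_apply _ hpre, hset,
    Measure.map_apply hZ (measurableSet_cell hpre),
    ← ofReal_integral_eq_lintegral_ofReal
      (integrable_of_continuous (hreg.continuous k ht)).integrableOn
      (ae_restrict_of_ae (hρ.ae_nonneg hreg ht k)),
    ← hρ.density k t ht _ hpre, ofReal_measureReal]
  rfl

theorem IsSymmetricDensity.setIntegral_law (hρ : IsSymmetricDensity P Z ρ)
    (hreg : IsSpatiallyC2 ρ) (ht : 0 < t) (hZ : Measurable (Z t)) (k : ℕ) (F : Config → ℝ) :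
    ∫ z in {z | z.1 = k}, F z ∂(P.map (Z t)) = ∫ y, ρ k t y * F ⟨k, y⟩ := by
  rw [hρ.restrict_law hreg ht hZ k, (measurableEmbedding_sigmaMk k).integral_map,
    integral_withDensity_eq_integral_toReal_smul
      (hreg.continuous k ht).measurable.ennreal_ofReal (ae_of_all _ fun _ => ENNReal.ofReal_lt_top)]
  refine integral_congr_ae ?_
  filter_upwards [hρ.ae_nonneg hreg ht k] with y hy
  rw [ENNReal.toReal_ofReal hy, smul_eq_mul]

theorem measurable_transProb {n : ℕ} {A : Set (Fin n → I)} (hA : MeasurableSet A) (h : ℝ) :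
    Measurable (transProb P Z t h n A) :=
  (Kernel.measurable_coe _ (measurableSet_cell hA)).ennreal_toReal

theorem abs_transProb_le_one {n : ℕ} (A : Set (Fin n → I)) (h : ℝ) (z : Config) :
    |transProb P Z t h n A z| ≤ 1 := by
  rw [transProb, abs_of_nonneg measureReal_nonneg]
  exact measureReal_le_one

theorem integrable_transProb (hZ : Measurable (Z t)) {n : ℕ} {A : Set (Fin n → I)}
    (hA : MeasurableSet A) (h : ℝ) : Integrable (transProb P Z t h n A) (P.map (Z t)) := by
  have : IsProbabilityMeasure (P.map (Z t)) := Measure.isProbabilityMeasure_map hZ.aemeasurable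
  exact Integrable.of_bound (measurable_transProb hA h).aestronglyMeasurable 1
    (ae_of_all _ fun z => abs_transProb_le_one A h z)

/-- Disintegration: averaging the conditional law at time `t + h` over the law at time `t` gives
back the law at time `t + h`. -/
theorem integral_transProb {h : ℝ} (hZ : Measurable (Z t)) (hZh : Measurable (Z (t + h)))
    {n : ℕ} {A : Set (Fin n → I)} (hA : MeasurableSet A) :
    ∫ z, transProb P Z t h n A z ∂(P.map (Z t)) = P.real {ω | Z (t + h) ω ∈ cell n A} := by
  have hc := measurableSet_cell hA
  have h1 := congrArg (fun μ => μ (cell n A))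
    (condDistrib_comp_map (μ := P) hZ.aemeasurable hZh.aemeasurable)
  rw [Measure.bind_apply hc (Kernel.aemeasurable _), Measure.map_apply hZh hc] at h1
  rw [measureReal_def, show {ω | Z (t + h) ω ∈ cell n A} = Z (t + h) ⁻¹' cell n A from rfl, ← h1]
  exact integral_toReal (Kernel.measurable_coe _ hc).aemeasurable
    (ae_of_all _ fun z => measure_lt_top _ _)

theorem SmallRemainder.tendsto_setIntegral {μ : Measure Config} [IsProbabilityMeasure μ]
    {S : Set Config} (hS : MeasurableSet S) {e : ℝ → Config → ℝ} (he : SmallRemainder μ S e) :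
    Tendsto (fun h => h⁻¹ * ∫ z in S, e h z ∂μ) (𝓝[>] 0) (𝓝 0) := by
  rw [Metric.tendsto_nhds]
  intro ε hε
  obtain ⟨δ, hδ, H⟩ := he (ε / 2) (by positivity)
  filter_upwards [self_mem_nhdsWithin, nhdsWithin_le_nhds (Iio_mem_nhds hδ)] with h hh hlt
  have hh' : 0 < h := hh
  have hb : ∀ᵐ z ∂μ.restrict S, ‖e h z‖ ≤ ε / 2 * h := by
    rw [ae_restrict_iff' hS]
    exact H h hh hlt
  have hn := norm_integral_le_of_norm_le_const hb
  have hμ : (μ.restrict S).real univ ≤ 1 := by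
    rw [measureReal_restrict_apply_univ]
    exact measureReal_le_one
  rw [dist_zero_right, norm_mul, Real.norm_eq_abs h⁻¹, abs_of_pos (inv_pos.2 hh')]
  calc h⁻¹ * ‖∫ z in S, e h z ∂μ‖ ≤ h⁻¹ * (ε / 2 * h * 1) := by
        gcongr
        exact hn.trans (by gcongr)
    _ = ε / 2 := by field_simp
    _ < ε := by linarith

/-- Up to `o(h)`, the probability to reach `A` from `k` particles is given by the main term of the
transition probability. -/
theorem tendsto_transProb_sub_main (hρ : IsSymmetricDensity P Z ρ)
    (hreg : IsSpatiallyC2 ρ) (ht : 0 < t) (hZ : Measurable (Z t)) {n : ℕ} {A : Set (Fin n → I)}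
    (hA : MeasurableSet A) (k : ℕ) {e : ℝ → Config → ℝ}
    (he : SmallRemainder (P.map (Z t)) {z | z.1 = k} e) {m : ℝ → (Fin k → I) → ℝ}
    (hm : ∀ h > 0, ∀ y, transProb P Z t h n A ⟨k, y⟩ = m h y + e h ⟨k, y⟩)
    (hmi : ∀ h > 0, Integrable fun y => ρ k t y * m h y) :
    Tendsto (fun h => h⁻¹ * ((∫ z in {z | z.1 = k}, transProb P Z t h n A z ∂(P.map (Z t)))
      - ∫ y, ρ k t y * m h y)) (𝓝[>] 0) (𝓝 0) := by
  have : IsProbabilityMeasure (P.map (Z t)) := Measure.isProbabilityMeasure_map hZ.aemeasurable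
  refine (he.tendsto_setIntegral (measurableSet_number (· = k))).congr' ?_
  filter_upwards [self_mem_nhdsWithin] with h hh
  -- The remainder `e` is not assumed measurable; its integral is handled as a difference of two
  -- integrable functions.
  have hT : Integrable fun y => ρ k t y * transProb P Z t h n A ⟨k, y⟩ := by
    simp only [mul_comm (ρ k t _)]
    exact (integrable_of_continuous (hreg.continuous k ht)).bdd_mul
      ((measurable_transProb hA h).comp
        (measurableEmbedding_sigmaMk k).measurable).aestronglyMeasurable
      (ae_of_all _ fun y => abs_transProb_le_one A h ⟨k, y⟩)
  have h1 := hρ.setIntegral_law hreg ht hZ k (e h)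
  have h2 := hρ.setIntegral_law hreg ht hZ k (transProb P Z t h n A)
  rw [h2, ← integral_sub hT (hmi h hh), h1]
  congr 2
  funext y
  rw [hm h hh y]
  ring

end Law

/-! ### Main terms of annihilation and creation -/

theorem continuous_removeNth {n : ℕ} (j : Fin (n + 1)) :
    Continuous fun u : Fin (n + 1) → I => (j.removeNth u : Fin n → I) :=
  continuous_pi fun i => continuous_apply (j.succAbove i)

theorem continuous_removePair {n : ℕ} (j : Fin (n + 1)) (k : Fin (n + 2)) :
    Continuous fun y : Fin (n + 2) → I => removePair y j k :=
  (continuous_removeNth j).comp (continuous_removeNth k)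

theorem continuous_append_pair (n : ℕ) :
    Continuous fun p : (Fin n → I) × (I × I) =>
      (Fin.append p.1 ![p.2.1, p.2.2] : Fin (n + 2) → I) := by
  refine continuous_pi fun i => ?_
  refine Fin.addCases (fun i => ?_) (fun i => ?_) i
  · simp only [Fin.append_left]
    fun_prop
  · simp only [Fin.append_right]
    fin_cases i
    · simpa using! continuous_fst.comp continuous_snd
    · simpa using! continuous_snd.comp continuous_snd

theorem continuous_pairRate {n : ℕ} {ld : I → I → ℝ} (hld : Continuous (Function.uncurry ld))
    (j k : Fin n) : Continuous fun y : Fin n → I => ld (y j) (y k) := by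
  have h1 : Continuous fun y : Fin n → I => (y j, y k) := by fun_prop
  have h2 := hld.comp h1
  simp only [Function.comp_def, Function.uncurry_apply_pair] at h2
  exact h2

theorem continuous_pairSum {n : ℕ} {ld : I → I → ℝ} (hld : Continuous (Function.uncurry ld)) :
    Continuous fun x : Fin n → I => pairSum ld x := by
  unfold pairSum
  refine continuous_finsetSum _ fun j _ => continuous_finsetSum _ fun k _ => ?_
  exact continuous_pairRate hld j k

/-- `∫ ld (q₁, q₂) f (x, q₁, q₂) dq`. -/
def pairIntegral {n : ℕ} (ld : I → I → ℝ) (f : (Fin (n + 2) → I) → ℝ) (x : Fin n → I) : ℝ :=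
  ∫ q : I × I, ld q.1 q.2 * f (Fin.append x ![q.1, q.2])

theorem continuous_pairIntegral {X : Type*} [TopologicalSpace X] [FirstCountableTopology X]
    [LocallyCompactSpace X] {n : ℕ} {ld : I → I → ℝ} (hld : Continuous (Function.uncurry ld))
    {F : X → (Fin (n + 2) → I) → ℝ} (hF : Continuous (Function.uncurry F)) :
    Continuous fun p : X × (Fin n → I) => pairIntegral ld (F p.1) p.2 := by
  have huniv : ∀ p : X × (Fin n → I), pairIntegral ld (F p.1) p.2
      = ∫ q in (univ : Set (I × I)), ld q.1 q.2 * F p.1 (Fin.append p.2 ![q.1, q.2]) := fun p => by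
    rw [setIntegral_univ, pairIntegral]
  simp only [huniv]
  refine continuous_parametric_integral_of_continuous
    (f := fun (p : X × (Fin n → I)) (q : I × I) =>
      ld q.1 q.2 * F p.1 (Fin.append p.2 ![q.1, q.2])) ?_ isCompact_univ
  have h1 : Continuous fun r : (X × (Fin n → I)) × (I × I) =>
      (r.1.1, (Fin.append r.1.2 ![r.2.1, r.2.2] : Fin (n + 2) → I)) :=
    (by fun_prop : Continuous fun r : (X × (Fin n → I)) × (I × I) => r.1.1).prodMk
      ((continuous_append_pair n).comp
        (by fun_prop : Continuous fun r : (X × (Fin n → I)) × (I × I) => (r.1.2, r.2)))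
  exact (hld.comp continuous_snd).mul (hF.comp h1)

/-- The survivors alone determine the hitting probability, so the two removed positions are
integrated out. By symmetry of `f` they may be placed last, and the result does not depend on the
pair. -/
theorem integral_hitProb_removePair {n : ℕ} {h : ℝ} (hh : 0 < h) (A : Set (Fin n → I))
    {ld : I → I → ℝ} (hld : Continuous (Function.uncurry ld)) {f : (Fin (n + 2) → I) → ℝ}
    (hf : Continuous f) (hsymm : ∀ (τ : Equiv.Perm (Fin (n + 2))) x, f (x ∘ τ) = f x)
    {j : Fin (n + 1)} {k : Fin (n + 2)} (hjk : j.castSucc < k) :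
    ∫ y, hitProb h A (removePair y j k) * (ld (y j.castSucc) (y k) * f y)
      = ∫ x, hitProb h A x * pairIntegral ld f x := by
  have hg : Continuous fun y : Fin (n + 2) → I => ld (y j.castSucc) (y k) * f y :=
    (continuous_pairRate hld j.castSucc k).mul hf
  have hG := integrable_hitProb_mul hh A (continuous_removePair j k).measurable hg
  -- As `j` precedes `k`, inserting at `k` afterwards does not shift the index of `j`.
  have hk : k.succAbove j = j.castSucc := Fin.succAbove_of_castSucc_lt k j hjk
  rw [integral_insertNth k hG, integral_insertNth j (integrable_insertNth k hG).integral_prod_right]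
  refine integral_congr_ae (ae_of_all _ fun x => ?_)
  have e1 : ∀ a b : I, removePair (k.insertNth b (j.insertNth a x : Fin (n + 1) → I)) j k = x := by
    intro a b
    simp [removePair, Fin.removeNth_insertNth]
  have e2 : ∀ a b : I,
      (k.insertNth b (j.insertNth a x : Fin (n + 1) → I) : Fin (n + 2) → I) j.castSucc = a := by
    intro a b
    rw [← hk]
    simp
  have e3 : ∀ a b : I,
      (k.insertNth b (j.insertNth a x : Fin (n + 1) → I) : Fin (n + 2) → I) k = b := by
    intro a b
    simp
  simp only [e1, e2, e3, symm_insertNth_insertNth hsymm, integral_const_mul]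
  rw [pairIntegral, Measure.volume_eq_prod, integral_prod]
  refine integrable_of_continuous ?_
  have h1 : Continuous fun q : I × I => (Fin.append x ![q.1, q.2] : Fin (n + 2) → I) :=
    (continuous_append_pair n).comp (by fun_prop : Continuous fun q : I × I => (x, q))
  exact hld.mul (hf.comp h1)

/-- The number of pairs among `n + 2` particles, which is the coefficient of the annihilation gain.
-/
theorem sum_pairs_one (n : ℕ) :
    ∑ k : Fin (n + 2), ∑ _j : Fin (n + 1) with _j.castSucc < k, (1 : ℝ)
      = ((n : ℝ) + 2) * ((n : ℝ) + 1) / 2 := by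
  have h1 : ∀ k : Fin (n + 2), ∑ _j : Fin (n + 1) with _j.castSucc < k, (1 : ℝ) = (k : ℕ) := by
    intro k
    have h2 := Fin.card_filter_val_lt (n := n + 1) (m := k)
    rw [min_eq_right (by omega)] at h2
    rw [Finset.sum_const, nsmul_eq_mul, mul_one, ← h2]
    rfl
  simp only [h1]
  rw [Fin.sum_univ_eq_sum_range (fun k => (k : ℝ)) (n + 2)]
  have h3 := Finset.sum_range_id_mul_two (n + 2)
  rw [Nat.add_succ_sub_one] at h3
  have h4 : (∑ k ∈ Finset.range (n + 2), (k : ℝ)) * 2 = ((n : ℝ) + 2) * (n + 1) := by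
    have h5 := congrArg (Nat.cast (R := ℝ)) h3
    push_cast at h5
    linarith
  linarith

/-- Fubini and the substitution `u = j.insertNth z y`: the created particle becomes coordinate `j`,
so the density just after creation is `lc (u j) * f (j.removeNth u)`. -/
theorem integral_hitProb_insertNth {n : ℕ} {h : ℝ} (hh : 0 < h) (A : Set (Fin (n + 1) → I))
    {lc : I → ℝ} (hlc : Continuous lc) {f : (Fin n → I) → ℝ} (hf : Continuous f)
    (j : Fin (n + 1)) :
    Integrable (fun y => f y * ∫ x in A, ∫ z : I, reflectedDensity h x (j.insertNth z y) * lc z) ∧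
    ∫ y, f y * (∫ x in A, ∫ z : I, reflectedDensity h x (j.insertNth z y) * lc z)
      = ∫ u, hitProb h A u * (lc (u j) * f (j.removeNth u)) := by
  have hcont : Continuous fun u : Fin (n + 1) → I => lc (u j) * f (j.removeNth u) :=
    (hlc.comp (continuous_apply j)).mul (hf.comp (continuous_removeNth j))
  have hG := integrable_hitProb_mul hh A measurable_id hcont
  simp only [id] at hG
  have heq : ∀ y : Fin n → I,
      f y * (∫ x in A, ∫ z : I, reflectedDensity h x (j.insertNth z y) * lc z)
        = ∫ z : I, hitProb h A (j.insertNth z y) * (lc ((j.insertNth z y : Fin (n + 1) → I) j)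
          * f (j.removeNth (j.insertNth z y : Fin (n + 1) → I))) := by
    intro y
    have hins : Measurable fun z : I => (j.insertNth z y : Fin (n + 1) → I) := by
      refine Continuous.measurable (continuous_pi fun i => ?_)
      refine Fin.succAboveCases j ?_ (fun i => ?_) i
      · simpa using! continuous_id
      · simpa using! continuous_const
    rw [setIntegral_integral_reflectedDensity hh A volume hins (integrable_of_continuous hlc),
      ← integral_const_mul]
    refine integral_congr_ae (ae_of_all _ fun z => ?_)
    simp only [Fin.insertNth_apply_same, Fin.removeNth_insertNth]
    ring
  simp only [heq]
  exact ⟨(integrable_insertNth j hG).integral_prod_right, (integral_insertNth j hG).symm⟩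

/-! ### Short-time limits of the contributions -/

section Limits

variable {Ω : Type*} [MeasurableSpace Ω] {P : Measure Ω} [IsProbabilityMeasure P]
  {Z : ℝ → Ω → Config} {ρ : (n : ℕ) → ℝ → (Fin n → I) → ℝ} {t : ℝ} {lc : I → ℝ}
  {ld : I → I → ℝ}

theorem tendsto_creation (hlc : Continuous lc) (hρ : IsSymmetricDensity P Z ρ)
    (hreg : IsSpatiallyC2 ρ) (htrans : ShortTimeTransitions P Z lc ld) (ht : 0 < t)
    (hZ : Measurable (Z t)) {n : ℕ} {A : Set (Fin n → I)} (hA : MeasurableSet A) :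
    Tendsto (fun h => h⁻¹ *
      ∫ z in {z | z.1 + 1 = n}, transProb P Z t h n A z ∂(P.map (Z t)))
      (𝓝[>] 0) (𝓝 (∫ x in A, creationGain lc ρ t n x)) := by
  rcases n with _ | n
  -- Writing the source as `z.1 + 1 = n` avoids truncated subtraction, so for `n = 0` the event is
  -- empty.
  · simp [creationGain]
  obtain ⟨e, he, hE⟩ := htrans.creation n A hA t ht
  have hf := hreg.continuous n ht
  have hmain : ∀ h > 0, Integrable (fun y => ρ n t y * (h * (1 / ((n : ℝ) + 1)) *
      ∑ j : Fin (n + 1), (∫ x in A, ∫ z : I, reflectedDensity h x (j.insertNth z y) * lc z))) ∧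
      h⁻¹ * ∫ y, ρ n t y * (h * (1 / ((n : ℝ) + 1)) *
        ∑ j : Fin (n + 1), (∫ x in A, ∫ z : I, reflectedDensity h x (j.insertNth z y) * lc z))
      = 1 / ((n : ℝ) + 1) * ∑ j : Fin (n + 1),
        ∫ u, hitProb h A u * (lc (u j) * ρ n t (j.removeNth u)) := by
    intro h hh
    have h1 := fun j => integral_hitProb_insertNth hh A hlc hf j
    have h2 : ∀ y, ρ n t y * (h * (1 / ((n : ℝ) + 1)) *
        ∑ j : Fin (n + 1), (∫ x in A, ∫ z : I, reflectedDensity h x (j.insertNth z y) * lc z))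
        = h * (1 / ((n : ℝ) + 1)) * ∑ j : Fin (n + 1), ρ n t y *
          (∫ x in A, ∫ z : I, reflectedDensity h x (j.insertNth z y) * lc z) := by
      intro y
      rw [← Finset.mul_sum]
      ring
    simp only [h2]
    refine ⟨(integrable_finsetSum _ fun j _ => (h1 j).1).const_mul _, ?_⟩
    rw [integral_const_mul, integral_finsetSum _ fun j _ => (h1 j).1]
    simp only [(h1 _).2]
    have hne : h ≠ 0 := ne_of_gt hh
    field_simp
  have hlim := tendsto_transProb_sub_main hρ hreg ht hZ hA n he hE fun h hh => (hmain h hh).1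
  have hc : ∀ j : Fin (n + 1), Continuous fun u : Fin (n + 1) → I =>
      lc (u j) * ρ n t (j.removeNth u) := fun j =>
    (hlc.comp (continuous_apply j)).mul (hf.comp (continuous_removeNth j))
  have hlim2 := (tendsto_finsetSum Finset.univ fun j _ =>
    tendsto_integral_hitProb_mul (hc j) A).const_mul (1 / ((n : ℝ) + 1))
  rw [← integral_finsetSum _ fun j _ => (integrable_of_continuous (hc j)).integrableOn,
    ← integral_const_mul] at hlim2
  have hlim3 := hlim.add hlim2
  rw [zero_add] at hlim3
  refine hlim3.congr' ?_
  filter_upwards [self_mem_nhdsWithin] with h hh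
  rw [← (hmain h hh).2]
  simp only [Nat.add_right_cancel_iff]
  ring

theorem tendsto_annihilation (hld : Continuous (Function.uncurry ld))
    (hρ : IsSymmetricDensity P Z ρ)
    (hreg : IsSpatiallyC2 ρ) (htrans : ShortTimeTransitions P Z lc ld) (ht : 0 < t)
    (hZ : Measurable (Z t)) {n : ℕ} {A : Set (Fin n → I)} (hA : MeasurableSet A) :
    Tendsto (fun h => h⁻¹ *
      ∫ z in {z | z.1 = n + 2}, transProb P Z t h n A z ∂(P.map (Z t)))
      (𝓝[>] 0) (𝓝 (∫ x in A, ((n : ℝ) + 2) * ((n : ℝ) + 1) / 2 *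
        pairIntegral ld (ρ (n + 2) t) x)) := by
  obtain ⟨e, he, hE⟩ := htrans.annihilation n A hA t ht
  have hf := hreg.continuous (n + 2) ht
  have hsymm := hρ.symm (n + 2) t ht
  have hmain : ∀ h > 0, Integrable (fun y => ρ (n + 2) t y *
      (h * (∑ k : Fin (n + 2), ∑ j : Fin (n + 1) with j.castSucc < k,
        ld (y j.castSucc) (y k) * ∫ x in A, reflectedDensity h x (removePair y j k)))) ∧
      h⁻¹ * ∫ y, ρ (n + 2) t y *
        (h * (∑ k : Fin (n + 2), ∑ j : Fin (n + 1) with j.castSucc < k,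
        ld (y j.castSucc) (y k) * ∫ x in A, reflectedDensity h x (removePair y j k)))
      = ((n : ℝ) + 2) * ((n : ℝ) + 1) / 2 *
        ∫ x, hitProb h A x * pairIntegral ld (ρ (n + 2) t) x := by
    intro h hh
    have hi : ∀ (k : Fin (n + 2)) (j : Fin (n + 1)),
        Integrable fun y => hitProb h A (removePair y j k) *
          (ld (y j.castSucc) (y k) * ρ (n + 2) t y) := fun k j =>
      integrable_hitProb_mul hh A (continuous_removePair j k).measurable
        ((continuous_pairRate hld j.castSucc k).mul hf)
    have h2 : ∀ y, ρ (n + 2) t y *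
        (h * (∑ k : Fin (n + 2), ∑ j : Fin (n + 1) with j.castSucc < k,
        ld (y j.castSucc) (y k) * ∫ x in A, reflectedDensity h x (removePair y j k)))
        = h * ∑ k : Fin (n + 2), ∑ j : Fin (n + 1) with j.castSucc < k,
          hitProb h A (removePair y j k) * (ld (y j.castSucc) (y k) * ρ (n + 2) t y) := by
      intro y
      rw [mul_left_comm, Finset.mul_sum]
      simp only [Finset.mul_sum, hitProb]
      refine Finset.sum_congr rfl fun k _ => Finset.sum_congr rfl fun j _ => ?_
      ring
    simp only [h2]
    have hi2 : ∀ k : Fin (n + 2), Integrable fun y => ∑ j : Fin (n + 1) with j.castSucc < k,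
        hitProb h A (removePair y j k) * (ld (y j.castSucc) (y k) * ρ (n + 2) t y) := fun k =>
      integrable_finsetSum _ fun j _ => hi k j
    refine ⟨(integrable_finsetSum _ fun k _ => hi2 k).const_mul _, ?_⟩
    rw [integral_const_mul, integral_finsetSum _ fun k _ => hi2 k, ← sum_pairs_one,
      Finset.sum_mul, inv_mul_cancel_left₀ (ne_of_gt hh)]
    refine Finset.sum_congr rfl fun k _ => ?_
    rw [integral_finsetSum _ fun j _ => hi k j, Finset.sum_mul]
    refine Finset.sum_congr rfl fun j hj => ?_
    rw [one_mul, integral_hitProb_removePair hh A hld hf hsymm (Finset.mem_filter.1 hj).2]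
  have hlim := tendsto_transProb_sub_main hρ hreg ht hZ hA (n + 2) he hE
    fun h hh => (hmain h hh).1
  have hc : Continuous fun x : Fin n → I => pairIntegral ld (ρ (n + 2) t) x :=
    -- Time is fixed here, so the parameter space is a single point.
    (continuous_pairIntegral (X := Unit) (F := fun _ => ρ (n + 2) t) hld
      (hf.comp continuous_snd)).comp (by fun_prop : Continuous fun x : Fin n → I => ((), x))
  have hlim2 := (tendsto_integral_hitProb_mul hc A).const_mul (((n : ℝ) + 2) * ((n : ℝ) + 1) / 2)
  rw [← integral_const_mul] at hlim2
  have hlim3 := hlim.add hlim2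
  rw [zero_add] at hlim3
  refine hlim3.congr' ?_
  filter_upwards [self_mem_nhdsWithin] with h hh
  rw [← (hmain h hh).2]
  ring

/-- The only contribution that is not small with `h`: subtracting its value at `h = 0` leaves the
generator and the two loss terms. The generator is why `A` must avoid the faces. -/
theorem tendsto_noReaction (hld : Continuous (Function.uncurry ld))
    (hρ : IsSymmetricDensity P Z ρ)
    (hreg : IsSpatiallyC2 ρ) (htrans : ShortTimeTransitions P Z lc ld) (ht : 0 < t)
    (hZ : Measurable (Z t)) {n : ℕ} {A : Set (Fin n → I)} (hA : MeasurableSet A) {δ : ℝ}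
    (hδ : 0 < δ) (hAδ : A ⊆ innerCube n δ) :
    Tendsto (fun h => h⁻¹ *
      ((∫ z in {z | z.1 = n}, transProb P Z t h n A z ∂(P.map (Z t))) - ∫ x in A, ρ n t x))
      (𝓝[>] 0) (𝓝 ((∫ x in A, ∑ i, secondPartial (ρ n t) i x)
        - ∫ x in A, ((∫ z : I, lc z) + pairSum ld x) * ρ n t x)) := by
  obtain ⟨e, he, hE⟩ := htrans.noReaction n A hA t ht
  have hf := hreg.continuous n ht
  have hg : Continuous fun x => ((∫ z : I, lc z) + pairSum ld x) * ρ n t x :=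
    (continuous_const.add (continuous_pairSum hld)).mul hf
  have hmain : ∀ h > 0, Integrable (fun y => ρ n t y *
      ((1 - h * (∫ z : I, lc z) - h * pairSum ld y) * (∫ x in A, reflectedDensity h x y))) ∧
      ∫ y, ρ n t y *
        ((1 - h * (∫ z : I, lc z) - h * pairSum ld y) * (∫ x in A, reflectedDensity h x y))
      = (∫ x in A, diffuse h (ρ n t) x)
        - h * ∫ y, hitProb h A y * (((∫ z : I, lc z) + pairSum ld y) * ρ n t y) := by
    intro h hh
    have h2 : ∀ y, ρ n t y *
        ((1 - h * (∫ z : I, lc z) - h * pairSum ld y) * (∫ x in A, reflectedDensity h x y))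
        = hitProb h A y * ρ n t y
          - h * (hitProb h A y * (((∫ z : I, lc z) + pairSum ld y) * ρ n t y)) := by
      intro y
      rw [← hitProb]
      ring
    simp only [h2]
    have i1 := integrable_hitProb_mul hh A measurable_id hf
    have i2 := (integrable_hitProb_mul hh A measurable_id hg).const_mul h
    simp only [id] at i1 i2
    refine ⟨i1.sub i2, ?_⟩
    rw [integral_sub i1 i2, integral_const_mul, integral_hitProb_mul hh A hf]
  have hlim := tendsto_transProb_sub_main hρ hreg ht hZ hA n he hE fun h hh => (hmain h hh).1
  have hlim3 := hlim.add (((hreg.isC2 n ht).tendsto_setIntegral_diffuse_sub hδ hA hAδ).sub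
    (tendsto_integral_hitProb_mul hg A))
  rw [zero_add] at hlim3
  refine hlim3.congr' ?_
  filter_upwards [self_mem_nhdsWithin] with h hh
  rw [(hmain h hh).2]
  have hne : h ≠ 0 := ne_of_gt hh
  field_simp
  ring

end Limits

/-! ### From right derivatives of integrals to the pointwise equation -/

section MasterEquation

variable {Ω : Type*} [MeasurableSpace Ω] {P : Measure Ω} [IsProbabilityMeasure P]
  {Z : ℝ → Ω → Config} {ρ : (n : ℕ) → ℝ → (Fin n → I) → ℝ} {t : ℝ} {lc : I → ℝ}
  {ld : I → I → ℝ}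

theorem integral_eq_sum_number {μ : Measure Config} {F : Config → ℝ} (hF : Integrable F μ)
    (n : ℕ) :
    ∫ z, F z ∂μ = (∫ z in {z | z.1 + 1 = n}, F z ∂μ) + ((∫ z in {z | z.1 = n}, F z ∂μ)
      + ((∫ z in {z | z.1 = n + 2}, F z ∂μ)
        + ∫ z in {z | z.1 + 1 ≠ n ∧ z.1 ≠ n ∧ z.1 ≠ n + 2}, F z ∂μ)) := by
  have hi : ∀ s, IntegrableOn F s μ := fun s => hF.integrableOn
  have hm : ∀ p : ℕ → Prop, MeasurableSet {z : Config | p z.1} := measurableSet_number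
  have hsplit : ∀ p q r : ℕ → Prop, (∀ k, r k ↔ p k ∨ q k) → (∀ k, p k → ¬q k) →
      ∫ z in {z | r z.1}, F z ∂μ = (∫ z in {z | p z.1}, F z ∂μ) + ∫ z in {z | q z.1}, F z ∂μ := by
    intro p q r hr hpq
    have hd : Disjoint {z : Config | p z.1} {z : Config | q z.1} :=
      Set.disjoint_left.2 fun z hz => hpq z.1 hz
    rw [← setIntegral_union hd (hm q) (hi _) (hi _)]
    congr 2
    ext z
    exact hr z.1
  rw [← hsplit (· = n + 2) (fun k => k + 1 ≠ n ∧ k ≠ n ∧ k ≠ n + 2)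
      (fun k => k + 1 ≠ n ∧ k ≠ n) (fun k => by omega) (fun k => by omega),
    ← hsplit (· = n) (fun k => k + 1 ≠ n ∧ k ≠ n) (fun k => k + 1 ≠ n) (fun k => by omega) (fun k => by omega),
    ← hsplit (fun k => k + 1 = n) (fun k => k + 1 ≠ n) (fun _ => True) (fun k => by tauto)
      (fun k => by tauto)]
  simp

/-- Time clamped from below, to turn functions on `(0, ∞)` into functions on the line. -/
theorem IsSpatiallyC2.continuous_clamp (hreg : IsSpatiallyC2 ρ) (n : ℕ) {c : ℝ} (hc : 0 < c) :
    Continuous (Function.uncurry fun (s : ℝ) (x : Fin n → I) => ρ n (max c s) x) :=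
  (hreg.continuousOn n).comp_continuous
    (f := fun q : ℝ × (Fin n → I) => (max c q.1, q.2)) (by fun_prop)
    fun _ => ⟨lt_max_of_lt_left hc, mem_univ _⟩

theorem continuous_creationGain_clamp (hlc : Continuous lc) (hreg : IsSpatiallyC2 ρ) (n : ℕ)
    {c : ℝ} (hc : 0 < c) :
    Continuous fun q : ℝ × (Fin n → I) => creationGain lc ρ (max c q.1) n q.2 := by
  rcases n with _ | n
  · simp only [creationGain]
    exact continuous_const
  · simp only [creationGain]
    refine continuous_const.mul (continuous_finsetSum _ fun i _ => ?_)
    have h1 : Continuous fun q : ℝ × (Fin (n + 1) → I) => (q.1, (i.removeNth q.2 : Fin n → I)) :=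
      continuous_fst.prodMk ((continuous_removeNth i).comp continuous_snd)
    have h2 := (hreg.continuous_clamp n hc).comp h1
    simp only [Function.comp_def, Function.uncurry_apply_pair] at h2
    exact (by fun_prop : Continuous fun q : ℝ × (Fin (n + 1) → I) => lc (q.2 i)).mul h2

theorem continuous_rhs_clamp (hlc : Continuous lc) (hld : Continuous (Function.uncurry ld))
    (hreg : IsSpatiallyC2 ρ) (n : ℕ) {c : ℝ} (hc : 0 < c) :
    Continuous (Function.uncurry fun (s : ℝ) (x : Fin n → I) => rhs lc ld ρ n (max c s) x) := by
  have h0 : Continuous fun q : ℝ × (Fin n → I) => ρ n (max c q.1) q.2 :=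
    hreg.continuous_clamp n hc
  have h1 : Continuous fun q : ℝ × (Fin n → I) =>
      ∑ i, secondPartial (ρ n (max c q.1)) i q.2 :=
    continuous_finsetSum _ fun i _ => (hreg.continuousOn_secondPartial n i).comp_continuous
      (f := fun q : ℝ × (Fin n → I) => (max c q.1, q.2)) (by fun_prop)
      fun _ => ⟨lt_max_of_lt_left hc, mem_univ _⟩
  have h2 : Continuous fun q : ℝ × (Fin n → I) =>
      pairIntegral ld (ρ (n + 2) (max c q.1)) q.2 :=
    continuous_pairIntegral (F := fun s => ρ (n + 2) (max c s)) hld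
      (hreg.continuous_clamp (n + 2) hc)
  have h3 : Continuous fun q : ℝ × (Fin n → I) => pairSum ld q.2 :=
    (continuous_pairSum hld).comp continuous_snd
  have h4 := continuous_creationGain_clamp hlc hreg n hc
  exact (((h1.add (continuous_const.mul h2)).sub (h3.mul h0)).add h4).sub (continuous_const.mul h0)

theorem tendsto_slope_setIntegral (hZ : ∀ t > 0, Measurable (Z t)) (hlc : Continuous lc)
    (hld : Continuous (Function.uncurry ld)) (hρ : IsSymmetricDensity P Z ρ)
    (hreg : IsSpatiallyC2 ρ) (htrans : ShortTimeTransitions P Z lc ld) (ht : 0 < t)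
    {n : ℕ} {A : Set (Fin n → I)} (hA : MeasurableSet A) {δ : ℝ}
    (hδ : 0 < δ) (hAδ : A ⊆ innerCube n δ) :
    Tendsto (fun h => h⁻¹ * ((∫ x in A, ρ n (t + h) x) - ∫ x in A, ρ n t x)) (𝓝[>] 0)
      (𝓝 (∫ x in A, rhs lc ld ρ n t x)) := by
  have hZt := hZ t ht
  have hprob : IsProbabilityMeasure (P.map (Z t)) :=
    Measure.isProbabilityMeasure_map hZt.aemeasurable
  have l1 := tendsto_creation hlc hρ hreg htrans ht hZt hA
  have l2 := tendsto_noReaction hld hρ hreg htrans ht hZt hA hδ hAδ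
  have l3 := tendsto_annihilation hld hρ hreg htrans ht hZt hA
  have l4 := (htrans.multiple n A hA t ht).tendsto_setIntegral
    (measurableSet_number fun k => k + 1 ≠ n ∧ k ≠ n ∧ k ≠ n + 2)
  have hlim := l1.add (l2.add (l3.add l4))
  have hρc := hreg.continuous n ht
  -- Continuity in space at the fixed time `t` is read off from the functions clamped at `t`.
  have hmax : max t t = t := max_self t
  have c1 : Continuous fun x : Fin n → I => creationGain lc ρ t n x := by
    have := (continuous_creationGain_clamp hlc hreg n ht).comp
      (by fun_prop : Continuous fun x : Fin n → I => (t, x))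
    simpa only [Function.comp_def, hmax] using this
  have c2 : Continuous fun x : Fin n → I => ∑ i, secondPartial (ρ n t) i x :=
    continuous_finsetSum _ fun i _ => (hreg.isC2 n ht).continuous_secondPartial i
  have c3 : Continuous fun x : Fin n → I => ((∫ z : I, lc z) + pairSum ld x) * ρ n t x :=
    (continuous_const.add (continuous_pairSum hld)).mul hρc
  have c4 : Continuous fun x : Fin n → I => ((n : ℝ) + 2) * ((n : ℝ) + 1) / 2 *
      pairIntegral ld (ρ (n + 2) t) x := by
    have := (continuous_pairIntegral (n := n) (F := fun s => ρ (n + 2) (max t s)) hld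
      (hreg.continuous_clamp (n + 2) ht)).comp
      (by fun_prop : Continuous fun x : Fin n → I => (t, x))
    simp only [Function.comp_def, hmax] at this
    exact continuous_const.mul this
  have hint : ∀ {g : (Fin n → I) → ℝ}, Continuous g → IntegrableOn g A := fun hg =>
    (integrable_of_continuous hg).integrableOn
  have c23 : Integrable (fun x => (∑ i, secondPartial (ρ n t) i x)
      - ((∫ z : I, lc z) + pairSum ld x) * ρ n t x) (volume.restrict A) :=
    Integrable.sub (hint c2) (hint c3)
  have hrhs : ∫ x in A, rhs lc ld ρ n t x = (∫ x in A, creationGain lc ρ t n x)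
      + (((∫ x in A, ∑ i, secondPartial (ρ n t) i x)
        - ∫ x in A, ((∫ z : I, lc z) + pairSum ld x) * ρ n t x)
      + ((∫ x in A, ((n : ℝ) + 2) * ((n : ℝ) + 1) / 2 * pairIntegral ld (ρ (n + 2) t) x) + 0)) := by
    rw [add_zero, ← integral_sub (hint c2) (hint c3),
      ← integral_add c23 (hint c4), ← integral_add (hint c1) (Integrable.fun_add c23 (hint c4))]
    refine integral_congr_ae (ae_of_all _ fun x => ?_)
    simp only [rhs, pairIntegral]
    ring
  rw [hrhs]
  refine hlim.congr' ?_
  filter_upwards [self_mem_nhdsWithin] with h hh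
  have hh' : (0 : ℝ) < h := hh
  rw [← hρ.density n (t + h) (by linarith) A hA,
    ← integral_transProb hZt (hZ (t + h) (by linarith)) hA,
    integral_eq_sum_number (integrable_transProb hZt hA h) n]
  ring

theorem continuous_setIntegral {n : ℕ} {F : ℝ → (Fin n → I) → ℝ}
    (hF : Continuous (Function.uncurry F)) (A : Set (Fin n → I)) :
    Continuous fun s => ∫ x in A, F s x := by
  have := continuous_parametric_integral_of_continuous (μ := volume.restrict A) hF isCompact_univ
  simpa only [Measure.restrict_univ] using this

theorem hasDerivWithinAt_Ici_of_tendsto {g : ℝ → ℝ} {g' s : ℝ}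
    (hg : Tendsto (fun h => h⁻¹ * (g (s + h) - g s)) (𝓝[>] 0) (𝓝 g')) :
    HasDerivWithinAt g g' (Ici s) s := by
  rw [← hasDerivWithinAt_Ioi_iff_Ici, hasDerivWithinAt_iff_tendsto_slope' (by simp)]
  have hsub : Tendsto (fun y : ℝ => y - s) (𝓝[>] s) (𝓝[>] 0) := by
    refine tendsto_nhdsWithin_iff.2 ⟨?_, ?_⟩
    · have : Continuous fun y : ℝ => y - s := by fun_prop
      simpa using (this.tendsto s).mono_left nhdsWithin_le_nhds
    · filter_upwards [self_mem_nhdsWithin] with y hy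
      exact sub_pos.2 (mem_Ioi.1 hy)
  refine (hg.comp hsub).congr fun y => ?_
  simp [slope_def_field, div_eq_inv_mul]

/-- Only right derivatives are available, as conditioning looks forward in time. A continuous
function with zero right derivative is constant; this is applied to the difference of `∫_A ρ` and
the primitive of `R`, and Fubini exchanges time and space. -/
theorem setIntegral_sub_eq (hZ : ∀ t > 0, Measurable (Z t)) (hlc : Continuous lc)
    (hld : Continuous (Function.uncurry ld)) (hρ : IsSymmetricDensity P Z ρ)
    (hreg : IsSpatiallyC2 ρ) (htrans : ShortTimeTransitions P Z lc ld) {b c : ℝ} (hc : 0 < c)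
    (hcb : c ≤ b) {n : ℕ} {A : Set (Fin n → I)} (hA : MeasurableSet A) {δ : ℝ}
    (hδ : 0 < δ) (hAδ : A ⊆ innerCube n δ) :
    (∫ x in A, ρ n b x) - ∫ x in A, ρ n c x
      = ∫ x in A, ∫ s in c..b, rhs lc ld ρ n (max c s) x := by
  have hrc := continuous_rhs_clamp hlc hld hreg n hc
  have hRc := continuous_setIntegral hrc A
  set R : ℝ → ℝ := fun s => ∫ x in A, rhs lc ld ρ n (max c s) x with hR
  have hgc := continuous_setIntegral (hreg.continuous_clamp n hc) A
  have hderiv : ∀ s ∈ Ico c b, HasDerivWithinAt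
      (fun s => (∫ x in A, ρ n (max c s) x) - ∫ r in c..s, R r) 0 (Ici s) s := by
    intro s hs
    have hs0 : 0 < s := hc.trans_le hs.1
    have hms : max c s = s := max_eq_right hs.1
    have d1 : HasDerivWithinAt (fun s => ∫ x in A, ρ n (max c s) x) (R s) (Ici s) s := by
      refine hasDerivWithinAt_Ici_of_tendsto ?_
      simp only [hR, hms]
      refine (tendsto_slope_setIntegral hZ hlc hld hρ hreg htrans hs0 hA hδ hAδ).congr' ?_
      filter_upwards [self_mem_nhdsWithin] with h hh
      have hh' : (0 : ℝ) < h := hh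
      rw [max_eq_right (by linarith [hs.1] : c ≤ s + h)]
    have d2 := (hRc.integral_hasStrictDerivAt c s).hasDerivAt.hasDerivWithinAt (s := Ici s)
    simpa using d1.fun_sub d2
  have hcont : ContinuousOn (fun s => (∫ x in A, ρ n (max c s) x) - ∫ r in c..s, R r)
      (Icc c b) :=
    (hgc.sub (intervalIntegral.continuous_primitive
      (fun _ _ => hRc.intervalIntegrable _ _) c)).continuousOn
  have hconst := constant_of_has_deriv_right_zero hcont hderiv b (right_mem_Icc.2 hcb)
  simp only [max_self, max_eq_right hcb, intervalIntegral.integral_same, sub_zero] at hconst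
  rw [sub_eq_iff_eq_add'.2 (sub_eq_iff_eq_add.1 hconst), hR]
  refine intervalIntegral_integral_swap ?_
  rw [← Measure.restrict_univ (μ := (volume.restrict A : Measure (Fin n → I))),
    Measure.prod_restrict]
  refine (hrc.continuousOn.integrableOn_compact (K := uIcc c b ×ˢ univ)
    (isCompact_uIcc.prod isCompact_univ)).mono_set ?_
  exact prod_mono uIoc_subset_uIcc subset_rfl

/-- Testing against all Borel subsets of an inner cube gives equality almost everywhere there. The
inner cubes exhaust the cube up to its null faces, and continuity in `x` does the rest. -/
theorem density_sub_eq (hZ : ∀ t > 0, Measurable (Z t)) (hlc : Continuous lc)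
    (hld : Continuous (Function.uncurry ld)) (hρ : IsSymmetricDensity P Z ρ)
    (hreg : IsSpatiallyC2 ρ) (htrans : ShortTimeTransitions P Z lc ld) {b c : ℝ} (hc : 0 < c)
    (hcb : c ≤ b) (n : ℕ) (x : Fin n → I) :
    ρ n b x - ρ n c x = ∫ s in c..b, rhs lc ld ρ n (max c s) x := by
  have hrc := continuous_rhs_clamp hlc hld hreg n hc
  have h1 : Continuous fun x => ρ n b x - ρ n c x :=
    (hreg.continuous n (hc.trans_le hcb)).sub (hreg.continuous n hc)
  have hsw : Continuous (Function.uncurry fun (x : Fin n → I) (s : ℝ) =>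
      rhs lc ld ρ n (max c s) x) := by
    have h := hrc.comp (continuous_swap (X := Fin n → I) (Y := ℝ))
    simp only [Function.comp_def, Function.uncurry_def, Prod.fst_swap, Prod.snd_swap] at h
    exact h
  have h2 : Continuous fun x => ∫ s in c..b, rhs lc ld ρ n (max c s) x :=
    intervalIntegral.continuous_parametric_intervalIntegral_of_continuous' hsw c b
  have hb := hreg.continuous n (hc.trans_le hcb)
  have hcc := hreg.continuous n hc
  have hinner : ∀ m : ℕ, ∀ᵐ x : Fin n → I, x ∈ innerCube n (1 / ((m : ℝ) + 1)) →
      ρ n b x - ρ n c x = ∫ s in c..b, rhs lc ld ρ n (max c s) x := by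
    intro m
    have hδ : (0 : ℝ) < 1 / ((m : ℝ) + 1) := by positivity
    have hmeas : MeasurableSet (innerCube n (1 / ((m : ℝ) + 1))) := by
      have : IsClosed (innerCube n (1 / ((m : ℝ) + 1))) := by
        simp only [innerCube, ofPred_forall, ofPred_and]
        refine isClosed_iInter fun i => ?_
        exact (isClosed_le (by fun_prop) (by fun_prop)).inter
          (isClosed_le (by fun_prop) (by fun_prop))
      exact this.measurableSet
    rw [← ae_restrict_iff' hmeas]
    refine Integrable.ae_eq_of_forall_setIntegral_eq _ _ (integrable_of_continuous h1)
      (integrable_of_continuous h2) fun s hs _ => ?_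
    rw [Measure.restrict_restrict hs,
      ← setIntegral_sub_eq hZ hlc hld hρ hreg htrans hc hcb (hs.inter hmeas) hδ inter_subset_right]
    exact integral_sub (integrable_of_continuous hb).integrableOn
      (integrable_of_continuous hcc).integrableOn
  have hae : (fun x => ρ n b x - ρ n c x) =ᵐ[volume]
      fun x => ∫ s in c..b, rhs lc ld ρ n (max c s) x := by
    -- A point off the faces has finitely many coordinates, each strictly inside, so one large `m`
    -- serves them all.
    have hne : ∀ᵐ x : Fin n → I, ∀ i, x i ≠ 0 ∧ x i ≠ 1 := by
      refine ae_all_iff.2 fun i => ?_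
      exact (Measure.ae_eval_ne (μ := fun _ : Fin n => (volume : Measure I)) i 0).and
        (Measure.ae_eval_ne (μ := fun _ : Fin n => (volume : Measure I)) i 1)
    filter_upwards [ae_all_iff.2 hinner, hne] with x hx hxi
    have hpos : ∀ i, ∀ᶠ m : ℕ in atTop,
        1 / ((m : ℝ) + 1) ≤ x i ∧ (x i : ℝ) ≤ 1 - 1 / ((m : ℝ) + 1) := by
      intro i
      have p0 : (0 : ℝ) < x i := unitInterval.pos_iff_ne_zero.2 (hxi i).1
      have p1 : (x i : ℝ) < 1 := unitInterval.lt_one_iff_ne_one.2 (hxi i).2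
      have hlim := tendsto_one_div_add_atTop_nhds_zero_nat (𝕜 := ℝ)
      filter_upwards [hlim.eventually (gt_mem_nhds p0),
        hlim.eventually (gt_mem_nhds (sub_pos.2 p1))] with m m0 m1
      exact ⟨m0.le, by linarith⟩
    obtain ⟨m, hm⟩ := (eventually_all.2 hpos).exists
    exact hx m hm
  exact congrFun ((Continuous.ae_eq_iff_eq volume h1 h2).1 hae) x

end MasterEquation

end CDME
end

theorem mainTheorem3 {Ω : Type*} [MeasurableSpace Ω] (P : Measure Ω) [IsProbabilityMeasure P]
    (Z : ℝ → Ω → CDME.Config) (hZ : ∀ t > 0, Measurable (Z t))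
    (lc : I → ℝ) (ld : I → I → ℝ)
    (hlc : Continuous lc) (hlc0 : ∀ x, 0 ≤ lc x)
    (hld : Continuous (Function.uncurry ld)) (hld0 : ∀ x y, 0 ≤ ld x y)
    (hldsymm : ∀ x y, ld x y = ld y x)
    (ρ : (n : ℕ) → ℝ → (Fin n → I) → ℝ)
    (hρ : CDME.IsSymmetricDensity P Z ρ)
    (hreg : CDME.IsSpatiallyC2 ρ)
    (htrans : CDME.ShortTimeTransitions P Z lc ld) :
    ∀ (n : ℕ) (t : ℝ), 0 < t → ∀ x : Fin n → I,
      HasDerivAt (fun s => ρ n s x) (CDME.rhs lc ld ρ n t x) t := by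
  intro n t ht x
  -- Starting the integrated equation at `t / 2` makes it valid on both sides of `t`, so
  -- differentiating the primitive gives a two-sided derivative.
  have hc : 0 < t / 2 := by positivity
  have hcont : Continuous fun s => CDME.rhs lc ld ρ n (max (t / 2) s) x := by
    have h := (CDME.continuous_rhs_clamp hlc hld hreg n hc).comp
      (by fun_prop : Continuous fun s : ℝ => (s, x))
    simp only [Function.comp_def, Function.uncurry_apply_pair] at h
    exact h
  have hd := ((hcont.integral_hasStrictDerivAt (t / 2) t).hasDerivAt).const_add (ρ n (t / 2) x)
  rw [max_eq_right (by linarith : t / 2 ≤ t)] at hd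
  refine hd.congr_of_eventuallyEq ?_
  filter_upwards [Ioi_mem_nhds (by linarith : t / 2 < t)] with s hs
  rw [← CDME.density_sub_eq hZ hlc hld hρ hreg htrans hc (le_of_lt hs) n x]
  ring
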